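/- A \emph{tropical (plane) curve} is a nonempty finite graph $\Gamma$ embedded in $\mathbb{R}^2$ with straight edges of rational slope, some of which may be unbounded rays (edges meet only at vertices, every vertex has an edge), such that at each vertex $v$ the primitive integer direction vectors $u_e$ of the edges $e$ emanating from $v$ satisfy $\sum_{e\ni v}u_e=0$. The dual polygon $P_v$ of a vertex $v$ is the convex lattice polygon having, for each edge $e$ at $v$, one edge of lattice length $1$ with outer normal $u_e$, and no other edges. Placing the $P_v$ so that the polygons of the two ends of each bounded edge are glued along the edge dual to it, one obtains the \emph{subdivided dual polygon} $\{P_v\}$ and the \emph{dual polygon} $P_\Gamma=\bigcup_v P_v$, both considered up to lattice translation. The curve is \emph{smooth} if each vertex is trivalent and each $P_v$ is a triangle of area $\frac12$. Its \emph{genus} is its first Betti number. If two tropical curves meet only in relative interiors of non-parallel edges, their intersection divisor is the sum of the common points $p$ with multiplicity $|\det(u,u')|$, where $u,u'$ are the primitive directions of the two edges through $p$. The \emph{stable intersection} $\Gamma\cdot\Gamma'$ is the limit, as $\epsilon\to0^+$, of the intersection divisors of $\Gamma$ and $\Gamma'+\epsilon c$, where $c\in\mathbb{R}^2$ is a vector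 such that $\Gamma$ and $\Gamma'+\epsilon c$ meet in this way for all small $\epsilon>0$. Let $\mathcal{R}_\Gamma^{st}$ be the set of divisors $\Gamma\cdot\Gamma'$, where $\Gamma'$ is any tropical curve whose dual polygon coincides with that of $\Gamma$. \textbf{Proposition.} Let $\Gamma$ be a smooth tropical plane curve of genus $g$ with $d$ vertices. Then $\mathcal{R}_\Gamma^{st}$ contains a $(d-g)$-dimensional set of divisors: there is an affine subspace $L\subseteq(\mathbb{R}^2)^d$ of dimension $d-g$ and a nonempty relatively open subset $W\subseteq L$ such that $W\subseteq\Gamma^d$ and $x_1+\dots+x_d\in\mathcal{R}_\Gamma^{st}$ for all $(x_1,\dots,x_d)\in W$. In fact, $W$ can be chosen so that each of these divisors is $\Gamma\cdot\Gamma'$ for a smooth tropical curve $\Gamma'$ with the same subdivided dual polygon as $\Gamma$. -/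

import Mathlib

open Filter Topology

noncomputable section

/-- The real plane. Only its linear and topological structure is used. -/
abbrev Plane := ℝ × ℝ

/-- A lattice vector, seen in the plane. -/
def latticeVec (u : ℤ × ℤ) : Plane := ((u.1 : ℝ), (u.2 : ℝ))

def latticeDet (u u' : ℤ × ℤ) : ℤ := u.1 * u'.2 - u.2 * u'.1

/-- Rotation by a right angle, `u ↦ (-u₂, u₁)`. -/
def latticeRot (u : ℤ × ℤ) : ℤ × ℤ := (-u.2, u.1)

/-- The face of `P` on which the linear functional `⟨·, u⟩` is maximal. -/
def planeFace (P : Set Plane) (u : ℤ × ℤ) : Set Plane :=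
  {x | x ∈ P ∧ ∀ y ∈ P, y.1 * u.1 + y.2 * u.2 ≤ x.1 * u.1 + x.2 * u.2}

/-- Combinatorial data of a finite graph drawn in the plane with straight edges, some of which may
be unbounded: positions of the vertices, the bounded edges, and for each vertex the set of
direction vectors of all edges (bounded or not) emanating from it. -/
structure PlaneGraph where
  n : ℕ
  pos : Fin n → Plane
  graph : SimpleGraph (Fin n)
  star : Fin n → Finset (ℤ × ℤ)

namespace PlaneGraph

/-- The bounded edge from `v` to `w` emanates from `v` in direction `u`. -/
def HeadsTo (Γ : PlaneGraph) (v : Fin Γ.n) (u : ℤ × ℤ) (w : Fin Γ.n) : Prop :=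
  u ∈ Γ.star v ∧ Γ.graph.Adj v w ∧ ∃ t : ℝ, 0 < t ∧ Γ.pos w = Γ.pos v + t • latticeVec u

/-- The edge emanating from `v` in direction `u` is an unbounded ray. -/
def IsRay (Γ : PlaneGraph) (v : Fin Γ.n) (u : ℤ × ℤ) : Prop :=
  u ∈ Γ.star v ∧ ∀ w, ¬ Γ.HeadsTo v u w

/-- `e` is the relative interior of an edge (bounded or unbounded) with direction vector `u`.
A bounded edge is listed with both directions `u` and `-u`. -/
def IsOpenEdge (Γ : PlaneGraph) (e : Set Plane) (u : ℤ × ℤ) : Prop :=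
  (∃ v w, Γ.HeadsTo v u w ∧ e = openSegment ℝ (Γ.pos v) (Γ.pos w)) ∨
  (∃ v, Γ.IsRay v u ∧ e = {x | ∃ t : ℝ, 0 < t ∧ x = Γ.pos v + t • latticeVec u})

/-- The underlying subset of the plane. -/
def support (Γ : PlaneGraph) : Set Plane :=
  {x | (∃ v, x = Γ.pos v) ∨ ∃ e u, Γ.IsOpenEdge e u ∧ x ∈ e}

/-- A (not necessarily smooth) tropical plane curve: a nonempty finite graph embedded in the plane
with straight edges of rational slope, some of which may be unbounded, such that the primitive
direction vectors of the edges at each vertex sum to zero. -/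
structure IsTropicalCurve (Γ : PlaneGraph) : Prop where
  nonempty : 0 < Γ.n
  pos_injective : Function.Injective Γ.pos
  star_nonempty : ∀ v, (Γ.star v).Nonempty
  primitive : ∀ v, ∀ u ∈ Γ.star v, IsCoprime u.1 u.2
  adj_heads : ∀ v w, Γ.graph.Adj v w → ∃ u, Γ.HeadsTo v u w
  /-- no vertex lies in the relative interior of an edge -/
  vertex_notMem : ∀ e u, Γ.IsOpenEdge e u → ∀ v, Γ.pos v ∉ e
  /-- distinct edges have disjoint relative interiors -/
  edge_disjoint : ∀ e u e' u', Γ.IsOpenEdge e u → Γ.IsOpenEdge e' u' → (e ∩ e').Nonempty → e = e'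
  balanced : ∀ v, ∑ u ∈ Γ.star v, u = 0

/-- Smoothness: each vertex is trivalent and its dual triangle has area `1/2`. The edge vectors of
that triangle are the rotated direction vectors, so twice its area is the absolute value of the
determinant of any two of them. -/
def IsSmooth (Γ : PlaneGraph) : Prop :=
  ∀ v, (Γ.star v).card = 3 ∧
    ∀ u ∈ Γ.star v, ∀ u' ∈ Γ.star v, u ≠ u' → |latticeDet u u'| = 1

/-- The genus: the first Betti number `#edges - #vertices + #components` of the graph of bounded
edges (unbounded rays contribute nothing to homology). -/
def genus (Γ : PlaneGraph) : ℤ :=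
  (Nat.card Γ.graph.edgeSet : ℤ) - Γ.n + Nat.card Γ.graph.ConnectedComponent

def translate (Γ : PlaneGraph) (c : Plane) : PlaneGraph where
  n := Γ.n
  pos := fun v => Γ.pos v + c
  graph := Γ.graph
  star := Γ.star

/-- `P` is a dual polygon of the vertex `v`: a convex lattice polygon whose edges are exactly, for
each edge of `Γ` at `v` with primitive direction `u`, one edge of lattice length one with outer
normal `u`. It is determined up to lattice translation. (A two-valent vertex has a segment.) -/
def IsDualCell (Γ : PlaneGraph) (v : Fin Γ.n) (P : Set Plane) : Prop :=
  P = convexHull ℝ (⋃ u ∈ Γ.star v, planeFace P u) ∧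
  (∀ u ∈ Γ.star v, ∃ m : ℤ × ℤ,
    planeFace P u = segment ℝ (latticeVec m) (latticeVec (m + latticeRot u))) ∧
  (∀ c : ℤ × ℤ, IsCoprime c.1 c.2 → c ∉ Γ.star v → (planeFace P c).Subsingleton)

/-- Dual cells of all the vertices, placed so that the cells of the two ends of a bounded edge are
glued along the edge dual to it. -/
def IsDualPlacement (Γ : PlaneGraph) (P : Fin Γ.n → Set Plane) : Prop :=
  (∀ v, Γ.IsDualCell v (P v)) ∧
  (∀ v u w, Γ.HeadsTo v u w → planeFace (P v) u = planeFace (P w) (-u))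

/-- The subdivided dual polygons `{P_v}` of `Γ`. The subdivided dual polygon is defined only up to
lattice translation; this is the collection of its representatives. -/
def dualSubdivisions (Γ : PlaneGraph) : Set (Set (Set Plane)) :=
  {S | ∃ P, Γ.IsDualPlacement P ∧ S = Set.range P}

/-- The dual polygons `⋃ P_v` of `Γ`: the lattice translates of a single polygon. -/
def dualPolygons (Γ : PlaneGraph) : Set (Set Plane) :=
  {Q | ∃ S ∈ Γ.dualSubdivisions, Q = ⋃₀ S}

/-- The dual polygons coincide (as polygons up to lattice translation). -/
def SameDualPolygon (Γ Γ' : PlaneGraph) : Prop :=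
  Γ.dualPolygons = Γ'.dualPolygons

/-- The subdivided dual polygons coincide (up to lattice translation). -/
def SameSubdividedDualPolygon (Γ Γ' : PlaneGraph) : Prop :=
  Γ.dualSubdivisions = Γ'.dualSubdivisions

end PlaneGraph

/-- The divisor `x₁ + ⋯ + x_k` of a tuple of points. -/
def divisorOf {k : ℕ} (x : Fin k → Plane) : Plane →₀ ℤ :=
  ∑ i, Finsupp.single (x i) 1

namespace PlaneGraph

/-- `Γ` and `Γ'` intersect properly, with intersection divisor `D`: each common point lies in the
relative interior of an edge of `Γ` and of an edge of `Γ'`, these edges are not parallel, and the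
point has multiplicity `|det(u, u')|` in `D`. -/
def IsProperIntersection (Γ Γ' : PlaneGraph) (D : Plane →₀ ℤ) : Prop :=
  (∀ p, p ∉ Γ.support ∩ Γ'.support → D p = 0) ∧
  (∀ p ∈ Γ.support ∩ Γ'.support, ∃ e u e' u', Γ.IsOpenEdge e u ∧ p ∈ e ∧
    Γ'.IsOpenEdge e' u' ∧ p ∈ e' ∧ latticeDet u u' ≠ 0 ∧ D p = |latticeDet u u'|)

/-- `D` is the stable intersection `Γ · Γ'`: for some vector `c`, the curves `Γ` and `ε c + Γ'`
intersect properly for all small `ε > 0`, and `D` is the limit of their intersection divisors as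
`ε → 0`. Convergence of effective divisors is convergence of the points, suitably labelled. -/
def IsStableIntersection (Γ Γ' : PlaneGraph) (D : Plane →₀ ℤ) : Prop :=
  ∃ (c : Plane) (k : ℕ) (p : ℝ → Fin k → Plane) (q : Fin k → Plane),
    (∀ᶠ ε in 𝓝[>] (0 : ℝ), Γ.IsProperIntersection (Γ'.translate (ε • c)) (divisorOf (p ε))) ∧
    Tendsto p (𝓝[>] (0 : ℝ)) (𝓝 q) ∧ D = divisorOf q

/-- The set `R_Γ^st` of divisors `Γ · Γ'`, where `Γ'` is any tropical curve with the same dual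
polygon as `Γ`. -/
def stableLocus (Γ : PlaneGraph) : Set (Plane →₀ ℤ) :=
  {D | ∃ Γ' : PlaneGraph, Γ'.IsTropicalCurve ∧ Γ.SameDualPolygon Γ' ∧ Γ.IsStableIntersection Γ' D}

/-- The pullback to `Γ^k` of a set of divisors along `Γ^k → Γ^k / S_k`. -/
def pullback (Γ : PlaneGraph) (k : ℕ) (R : Set (Plane →₀ ℤ)) : Set (Fin k → Plane) :=
  {x | (∀ i, x i ∈ Γ.support) ∧ divisorOf x ∈ R}

end PlaneGraph

end

/-!
Displace the vertices of `Γ` by small vectors `δ v` that preserve the slopes of the bounded edges.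
The displaced curve is smooth with the same subdivided dual polygon. Its intersection with `Γ` is
made linear in `δ` by fixing `c = (1, √2)`, which is parallel to no edge, and taking each `δ v`
close to a small multiple of `c`. At each vertex name the three directions `I, J, K` so that `c`
lies in the open cone spanned by `I` and `I + J`. A vector `x` of this cone satisfies
`x = gap x • J - coordI x • K` with positive coefficients, so the translate by `x` of a tripod meets
the tripod only in the point `gap x • J`, with multiplicity `1`. Hence the intersection divisor is
`∑ v, (pos v + gap (δ v) • J v)`, and the claim is a lower bound for the rank of
`δ ↦ (gap (δ v) • J v)_v` on the space of slope-preserving displacements.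

That space has dimension at least `2n - E`, so it suffices that the kernel on it has dimension at
most the number `C` of components: then the rank is at least `2n - E - C = n - g`. For `δ` in the
kernel `δ v` is a multiple of `K v`. If it is nonzero, it is transverse to the arms `I v` and `J v`,
which forces the displacement to be nonzero at their far ends too, and the arms to be arms there.
So the arms at the vertices moved by `δ` form unbounded broken lines. As the two arms at a vertex
lie on opposite sides of the direction `c`, the region below these lines is open away from them, and
the third edge at each vertex enters it; hence a whole component of `Γ` lies below the lines as soon
as one of its vertices does. In particular the vertex of a component next to the topmost point of
all such lines is moved by every `δ` in the kernel that moves anything in this component, so its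
displacement, a multiple of `K`, determines `δ` there.
-/

noncomputable section

/-! ### Determinants and lattice vectors -/

/-- The determinant of two vectors of the plane, as a bilinear form. -/
def planeDet : Plane →ₗ[ℝ] Plane →ₗ[ℝ] ℝ :=
  LinearMap.mk₂ ℝ (fun p q => p.1 * q.2 - p.2 * q.1)
    (fun _ _ _ => by simp only [Prod.fst_add, Prod.snd_add]; ring)
    (fun _ _ _ => by simp only [Prod.smul_fst, Prod.smul_snd, smul_eq_mul]; ring)
    (fun _ _ _ => by simp only [Prod.fst_add, Prod.snd_add]; ring)
    (fun _ _ _ => by simp only [Prod.smul_fst, Prod.smul_snd, smul_eq_mul]; ring)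

theorem planeDet_apply (p q : Plane) : planeDet p q = p.1 * q.2 - p.2 * q.1 := rfl

@[simp]
theorem planeDet_self (p : Plane) : planeDet p p = 0 := by
  rw [planeDet_apply]; ring

theorem neg_planeDet (p q : Plane) : -planeDet p q = planeDet q p := by
  rw [planeDet_apply, planeDet_apply]; ring

theorem planeDet_smul_eq_add (p q x : Plane) :
    planeDet p q • x = planeDet x q • p + planeDet p x • q := by
  ext <;> simp only [planeDet_apply, Prod.smul_fst, Prod.smul_snd, Prod.fst_add, Prod.snd_add,
    smul_eq_mul] <;> ring

@[fun_prop]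
theorem continuous_planeDet (p : Plane) : Continuous (planeDet p) :=
  LinearMap.continuous_of_finiteDimensional _

theorem exists_smul_eq_of_planeDet_eq_zero {p q : Plane} (hp : p ≠ 0) (h : planeDet p q = 0) :
    ∃ t : ℝ, t • p = q := by
  obtain ⟨r, hr⟩ : ∃ r, planeDet p r ≠ 0 := by
    by_contra! hzero
    have h1 := hzero (0, 1)
    have h2 := hzero (1, 0)
    simp only [planeDet_apply, mul_one, mul_zero, sub_zero, zero_sub, neg_eq_zero] at h1 h2
    exact hp (Prod.ext h1 h2)
  refine ⟨planeDet q r / planeDet p r, ?_⟩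
  rw [div_eq_inv_mul, mul_smul, inv_smul_eq_iff₀ hr, planeDet_smul_eq_add p r q, h, zero_smul,
    add_zero]

theorem add_smul_eq_add_smul_iff {c u : Plane} (h : planeDet c u ≠ 0) {x p : Plane} {τ t : ℝ} :
    x + τ • c = p + t • u ↔
      t = planeDet c (x - p) / planeDet c u ∧ τ = planeDet u (x - p) / planeDet c u := by
  have hcramer := planeDet_smul_eq_add c u (x - p)
  constructor
  · intro heq
    have hx : x - p = t • u - τ • c := by rw [eq_sub_iff_add_eq, sub_add_eq_add_sub, heq]; abel
    simp only [hx, map_sub, map_smul, planeDet_self, smul_eq_mul, mul_zero, sub_zero, zero_sub,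
      ← mul_neg, neg_planeDet]
    exact ⟨(mul_div_cancel_right₀ _ h).symm, (mul_div_cancel_right₀ _ h).symm⟩
  · rintro ⟨rfl, rfl⟩
    have hx : x - p = (planeDet c u)⁻¹ • (planeDet (x - p) u • c + planeDet c (x - p) • u) := by
      rw [← hcramer, inv_smul_smul₀ h]
    rw [← sub_eq_iff_eq_add', add_sub_right_comm, ← neg_planeDet (x - p) u]
    nth_rewrite 1 [hx]
    module

theorem latticeVec_neg (u : ℤ × ℤ) : latticeVec (-u) = -latticeVec u := by
  ext <;> simp [latticeVec]

theorem latticeVec_add (u u' : ℤ × ℤ) : latticeVec (u + u') = latticeVec u + latticeVec u' := by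
  ext <;> simp [latticeVec]

theorem latticeVec_smul (k : ℤ) (u : ℤ × ℤ) : latticeVec (k • u) = (k : ℝ) • latticeVec u := by
  ext <;> simp [latticeVec]

theorem planeDet_latticeVec (u u' : ℤ × ℤ) :
    planeDet (latticeVec u) (latticeVec u') = latticeDet u u' := by
  simp [planeDet_apply, latticeVec, latticeDet]

theorem latticeVec_ne_zero {u : ℤ × ℤ} (hu : IsCoprime u.1 u.2) : latticeVec u ≠ 0 := by
  intro h
  obtain ⟨h1, h2⟩ : u.1 = 0 ∧ u.2 = 0 := by simpa [latticeVec] using h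
  rw [h1, h2] at hu
  exact not_isCoprime_zero_zero hu

theorem exists_zsmul_eq_of_latticeDet_eq_zero {u u' : ℤ × ℤ} (hu : IsCoprime u.1 u.2)
    (h : latticeDet u u' = 0) : ∃ k : ℤ, k • u = u' := by
  obtain ⟨a, b, hab⟩ := hu
  rw [latticeDet] at h
  refine ⟨a * u'.1 + b * u'.2, Prod.ext ?_ ?_⟩ <;>
    simp only [Prod.smul_fst, Prod.smul_snd, smul_eq_mul]
  · linear_combination u'.1 * hab + b * h
  · linear_combination u'.2 * hab - a * h

theorem eq_of_smul_latticeVec_eq {u u' : ℤ × ℤ} (hu : IsCoprime u.1 u.2)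
    (hu' : IsCoprime u'.1 u'.2) {t t' : ℝ} (ht : 0 < t) (ht' : 0 < t')
    (h : t • latticeVec u = t' • latticeVec u') : u = u' := by
  have hdet : latticeDet u u' = 0 := by
    have hprod : t' * planeDet (latticeVec u) (latticeVec u') = 0 := by
      rw [← smul_eq_mul, ← map_smul, ← h, map_smul, planeDet_self, smul_zero]
    exact_mod_cast planeDet_latticeVec u u' ▸ (mul_eq_zero.1 hprod).resolve_left ht'.ne'
  obtain ⟨k, rfl⟩ := exists_zsmul_eq_of_latticeDet_eq_zero hu hdet
  have hk : IsUnit k := hu'.isUnit_of_dvd' (Dvd.intro _ rfl) (Dvd.intro _ rfl)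
  have htk : t = t' * k := by
    rw [latticeVec_smul, smul_smul] at h
    exact smul_left_injective ℝ (latticeVec_ne_zero hu) h
  rcases Int.isUnit_iff.1 hk with rfl | rfl
  · rw [one_smul]
  · push_cast at htk
    linarith

/-! ### Edges of a plane graph -/

namespace PlaneGraph

variable {Γ : PlaneGraph} {v w : Fin Γ.n} {u : ℤ × ℤ}

/-- Every edge is primitive, has at most one far end, and can be traversed backwards: what it takes
for an edge to be a well-defined segment or ray. -/
structure IsReversible (Γ : PlaneGraph) : Prop where
  primitive : ∀ v, ∀ u ∈ Γ.star v, IsCoprime u.1 u.2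
  heads_unique : ∀ v u w w', Γ.HeadsTo v u w → Γ.HeadsTo v u w' → w = w'
  heads_symm : ∀ v u w, Γ.HeadsTo v u w → Γ.HeadsTo w (-u) v

/-- The parameters `t` for which `pos v + t • u` lies on the closed edge emanating from `v` in
direction `u`. -/
def reach (Γ : PlaneGraph) (v : Fin Γ.n) (u : ℤ × ℤ) : Set ℝ :=
  {t | 0 ≤ t ∧ ∀ w s, Γ.HeadsTo v u w → Γ.pos w = Γ.pos v + s • latticeVec u → t ≤ s}

/-- The edge emanating from `v` in direction `u`, bounded or not, including its ends. -/
def closedEdge (Γ : PlaneGraph) (v : Fin Γ.n) (u : ℤ × ℤ) : Set Plane :=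
  (fun t : ℝ => Γ.pos v + t • latticeVec u) '' Γ.reach v u

/-- The relative interior of the edge emanating from `v` in direction `u`. -/
def openEdge (Γ : PlaneGraph) (v : Fin Γ.n) (u : ℤ × ℤ) : Set Plane :=
  (fun t : ℝ => Γ.pos v + t • latticeVec u) '' interior (Γ.reach v u)

theorem openEdge_subset_closedEdge : Γ.openEdge v u ⊆ Γ.closedEdge v u :=
  Set.image_mono interior_subset

theorem exists_headsTo_or_isRay (hu : u ∈ Γ.star v) : (∃ w, Γ.HeadsTo v u w) ∨ Γ.IsRay v u := by
  by_cases h : ∃ w, Γ.HeadsTo v u w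
  · exact Or.inl h
  · exact Or.inr ⟨hu, not_exists.1 h⟩

theorem IsRay.reach_eq (h : Γ.IsRay v u) : Γ.reach v u = Set.Ici 0 :=
  Set.ext fun _ => ⟨And.left, fun ht => ⟨ht, fun w _ hw => absurd hw (h.2 w)⟩⟩

theorem ordConnected_reach : (Γ.reach v u).OrdConnected :=
  ⟨fun _ hx _ hy _ hz => ⟨hx.1.trans hz.1, fun w s hw hs => hz.2.trans (hy.2 w s hw hs)⟩⟩

theorem pos_of_mem_interior_reach {t : ℝ} (ht : t ∈ interior (Γ.reach v u)) : 0 < t := by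
  have hpos : interior (Γ.reach v u) ⊆ Set.Ioi 0 :=
    interior_Ici (a := (0 : ℝ)) ▸ interior_mono fun _ => And.left
  exact hpos ht

theorem convex_openEdge : Convex ℝ (Γ.openEdge v u) := by
  rw [openEdge, ← Set.image_image (fun p => Γ.pos v + p) (fun t : ℝ => t • latticeVec u)]
  exact (ordConnected_reach.convex.interior.is_linear_image
    (IsLinearMap.isLinearMap_smul' (latticeVec u))).translate _

namespace IsReversible

variable (R : Γ.IsReversible)
include R

theorem latticeVec_ne_zero (hu : u ∈ Γ.star v) : latticeVec u ≠ 0 :=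
  _root_.latticeVec_ne_zero (R.primitive v u hu)

theorem reach_eq (h : Γ.HeadsTo v u w) {s : ℝ} (hs : Γ.pos w = Γ.pos v + s • latticeVec u) :
    Γ.reach v u = Set.Icc 0 s := by
  refine Set.ext fun t => ⟨fun ht => ⟨ht.1, ht.2 w s h hs⟩, fun ht => ⟨ht.1, ?_⟩⟩
  intro w' s' h' hs'
  obtain rfl := R.heads_unique _ _ _ _ h h'
  have hss' : s = s' :=
    smul_left_injective ℝ (R.latticeVec_ne_zero h.1) (add_left_cancel (hs.symm.trans hs'))
  exact hss' ▸ ht.2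

theorem reach_eq_Icc_or_Ici (hu : u ∈ Γ.star v) :
    (∃ s > 0, Γ.reach v u = Set.Icc 0 s) ∨ Γ.reach v u = Set.Ici 0 := by
  rcases exists_headsTo_or_isRay hu with ⟨w, h⟩ | h
  · obtain ⟨s, hs, hw⟩ := h.2.2
    exact Or.inl ⟨s, hs, R.reach_eq h hw⟩
  · exact Or.inr h.reach_eq

theorem zero_mem_reach (hu : u ∈ Γ.star v) : 0 ∈ Γ.reach v u := by
  rcases R.reach_eq_Icc_or_Ici hu with ⟨s, hs, h⟩ | h <;> rw [h]
  exacts [Set.left_mem_Icc.2 hs.le, Set.self_mem_Ici]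

theorem interior_reach_mem_nhdsGT (hu : u ∈ Γ.star v) : interior (Γ.reach v u) ∈ 𝓝[>] 0 := by
  rcases R.reach_eq_Icc_or_Ici hu with ⟨s, hs, h⟩ | h <;> rw [h]
  · rw [interior_Icc]
    exact Ioo_mem_nhdsGT hs
  · rw [interior_Ici]
    exact self_mem_nhdsWithin

theorem reach_mem_nhdsGE (hu : u ∈ Γ.star v) : Γ.reach v u ∈ 𝓝[≥] 0 := by
  rcases R.reach_eq_Icc_or_Ici hu with ⟨s, hs, h⟩ | h <;> rw [h]
  exacts [Icc_mem_nhdsGE hs, self_mem_nhdsWithin]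

theorem isClosed_reach (hu : u ∈ Γ.star v) : IsClosed (Γ.reach v u) := by
  rcases R.reach_eq_Icc_or_Ici hu with ⟨s, -, h⟩ | h <;> rw [h]
  exacts [isClosed_Icc, isClosed_Ici]

theorem closure_interior_reach (hu : u ∈ Γ.star v) :
    closure (interior (Γ.reach v u)) = Γ.reach v u := by
  rcases R.reach_eq_Icc_or_Ici hu with ⟨s, hs, h⟩ | h <;> rw [h]
  · rw [interior_Icc, closure_Ioo hs.ne]
  · rw [interior_Ici, closure_Ioi]

theorem pos_mem_closedEdge (hu : u ∈ Γ.star v) : Γ.pos v ∈ Γ.closedEdge v u :=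
  ⟨0, R.zero_mem_reach hu, by simp⟩

theorem isClosedEmbedding_edge (hu : u ∈ Γ.star v) :
    IsClosedEmbedding fun t : ℝ => Γ.pos v + t • latticeVec u :=
  (Homeomorph.addLeft (Γ.pos v)).isClosedEmbedding.comp
    (isClosedEmbedding_smul_left (R.latticeVec_ne_zero hu))

theorem closure_openEdge (hu : u ∈ Γ.star v) : closure (Γ.openEdge v u) = Γ.closedEdge v u := by
  rw [openEdge, (R.isClosedEmbedding_edge hu).closure_image_eq, R.closure_interior_reach hu,
    closedEdge]

theorem isClosed_closedEdge (hu : u ∈ Γ.star v) : IsClosed (Γ.closedEdge v u) :=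
  R.closure_openEdge hu ▸ isClosed_closure

theorem closedEdge_eq_segment (h : Γ.HeadsTo v u w) :
    Γ.closedEdge v u = segment ℝ (Γ.pos v) (Γ.pos w) := by
  obtain ⟨s, hs, hw⟩ := h.2.2
  have hscale : Set.Icc 0 s = (fun θ : ℝ => θ * s) '' Set.Icc 0 1 := by
    rw [Set.image_mul_right_Icc zero_le_one hs.le, zero_mul, one_mul]
  rw [closedEdge, R.reach_eq h hw, hscale, Set.image_image, segment_eq_image', hw,
    add_sub_cancel_left]
  simp only [smul_smul]

theorem openEdge_eq_openSegment (h : Γ.HeadsTo v u w) :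
    Γ.openEdge v u = openSegment ℝ (Γ.pos v) (Γ.pos w) := by
  obtain ⟨s, hs, hw⟩ := h.2.2
  have hscale : Set.Ioo 0 s = (fun θ : ℝ => θ * s) '' Set.Ioo 0 1 := by
    rw [Set.image_mul_right_Ioo 0 1 hs, zero_mul, one_mul]
  rw [openEdge, R.reach_eq h hw, interior_Icc, hscale, Set.image_image, openSegment_eq_image', hw,
    add_sub_cancel_left]
  simp only [smul_smul]

theorem pos_notMem_openEdge (hu : u ∈ Γ.star v) : Γ.pos v ∉ Γ.openEdge v u := by
  rintro ⟨t, ht, h⟩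
  rw [add_eq_left] at h
  exact smul_ne_zero (pos_of_mem_interior_reach ht).ne' (R.latticeVec_ne_zero hu) h

theorem pos_notMem_openEdge_of_headsTo (h : Γ.HeadsTo v u w) : Γ.pos w ∉ Γ.openEdge v u := by
  obtain ⟨s, -, hw⟩ := h.2.2
  rintro ⟨t, ht, htw⟩
  rw [R.reach_eq h hw, interior_Icc] at ht
  exact ht.2.ne (smul_left_injective ℝ (R.latticeVec_ne_zero h.1)
    (add_left_cancel (htw.trans hw)))

theorem mem_closedEdge_cases {x : Plane} (hu : u ∈ Γ.star v) (hx : x ∈ Γ.closedEdge v u) :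
    x ∈ Γ.openEdge v u ∨ x = Γ.pos v ∨ ∃ w, Γ.HeadsTo v u w ∧ x = Γ.pos w := by
  rcases exists_headsTo_or_isRay hu with ⟨w, h⟩ | h
  · rw [R.closedEdge_eq_segment h] at hx
    rw [R.openEdge_eq_openSegment h]
    by_cases hv : x = Γ.pos v
    · exact Or.inr (Or.inl hv)
    by_cases hw : x = Γ.pos w
    · exact Or.inr (Or.inr ⟨w, h, hw⟩)
    · exact Or.inl (mem_openSegment_of_ne_left_right (Ne.symm hv) (Ne.symm hw) hx)
  · obtain ⟨t, ht, rfl⟩ := hx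
    rw [openEdge]
    rw [h.reach_eq] at ht ⊢
    rcases (Set.mem_Ici.1 ht).eq_or_lt with rfl | hpos
    · simp
    · exact Or.inl ⟨t, by rwa [interior_Ici], rfl⟩

theorem isOpenEdge_iff {e : Set Plane} :
    Γ.IsOpenEdge e u ↔ ∃ v, u ∈ Γ.star v ∧ e = Γ.openEdge v u := by
  have hray : ∀ v, Γ.IsRay v u →
      Γ.openEdge v u = {x | ∃ t : ℝ, 0 < t ∧ x = Γ.pos v + t • latticeVec u} := fun v hv => by
    ext x
    simp only [openEdge, hv.reach_eq, interior_Ici, Set.mem_image, Set.mem_Ioi, Set.mem_ofPred_eq,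
      eq_comm]
  constructor
  · rintro (⟨v, w, h, rfl⟩ | ⟨v, h, rfl⟩)
    · exact ⟨v, h.1, (R.openEdge_eq_openSegment h).symm⟩
    · exact ⟨v, h.1, (hray v h).symm⟩
  · rintro ⟨v, hu, rfl⟩
    rcases exists_headsTo_or_isRay hu with ⟨w, h⟩ | h
    · exact Or.inl ⟨v, w, h, R.openEdge_eq_openSegment h⟩
    · exact Or.inr ⟨v, h, hray v h⟩

theorem mem_support_iff (hne : ∀ v, (Γ.star v).Nonempty) {x : Plane} :
    x ∈ Γ.support ↔ ∃ v, ∃ u ∈ Γ.star v, x ∈ Γ.closedEdge v u := by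
  constructor
  · rintro (⟨v, rfl⟩ | ⟨e, u, he, hx⟩)
    · obtain ⟨u, hu⟩ := hne v
      exact ⟨v, u, hu, R.pos_mem_closedEdge hu⟩
    · obtain ⟨v, hu, rfl⟩ := R.isOpenEdge_iff.1 he
      exact ⟨v, u, hu, openEdge_subset_closedEdge hx⟩
  · rintro ⟨v, u, hu, hx⟩
    rcases R.mem_closedEdge_cases hu hx with h | h | ⟨w, -, h⟩
    · exact Or.inr ⟨_, u, R.isOpenEdge_iff.2 ⟨v, hu, rfl⟩, h⟩
    · exact Or.inl ⟨v, h⟩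
    · exact Or.inl ⟨w, h⟩

theorem eq_pos_of_mem_closedEdge {u' : ℤ × ℤ} (hu : u ∈ Γ.star v) (hu' : u' ∈ Γ.star v)
    (hne : u ≠ u') {x : Plane} (hx : x ∈ Γ.closedEdge v u) (hx' : x ∈ Γ.closedEdge v u') :
    x = Γ.pos v := by
  obtain ⟨t, ht, rfl⟩ := hx
  obtain ⟨t', ht', h⟩ := hx'
  rcases ht.1.eq_or_lt with rfl | hpos
  · simp
  rcases ht'.1.eq_or_lt with rfl | hpos'
  · simpa using h.symm
  · exact absurd (eq_of_smul_latticeVec_eq (R.primitive _ _ hu) (R.primitive _ _ hu') hpos hpos'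
      (add_left_cancel h.symm)) hne

end IsReversible

/-- `(z, a)` and `(v, u)` describe the same edge, possibly from opposite ends. -/
def SameEdge (Γ : PlaneGraph) (z : Fin Γ.n) (a : ℤ × ℤ) (v : Fin Γ.n) (u : ℤ × ℤ) : Prop :=
  (z = v ∧ a = u) ∨ (Γ.HeadsTo v u z ∧ a = -u)

namespace SameEdge

variable {z : Fin Γ.n} {a : ℤ × ℤ}

theorem closedEdge_eq (h : Γ.SameEdge z a v u) (R : Γ.IsReversible) :
    Γ.closedEdge z a = Γ.closedEdge v u := by
  rcases h with ⟨rfl, rfl⟩ | ⟨h, rfl⟩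
  · rfl
  · rw [R.closedEdge_eq_segment h, R.closedEdge_eq_segment (R.heads_symm _ _ _ h), segment_symm]

theorem openEdge_eq (h : Γ.SameEdge z a v u) (R : Γ.IsReversible) :
    Γ.openEdge z a = Γ.openEdge v u := by
  rcases h with ⟨rfl, rfl⟩ | ⟨h, rfl⟩
  · rfl
  · rw [R.openEdge_eq_openSegment h, R.openEdge_eq_openSegment (R.heads_symm _ _ _ h),
      openSegment_symm]

theorem symm (h : Γ.SameEdge z a v u) (R : Γ.IsReversible) : Γ.SameEdge v u z a := by
  rcases h with ⟨rfl, rfl⟩ | ⟨h, rfl⟩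
  · exact Or.inl ⟨rfl, rfl⟩
  · exact Or.inr ⟨R.heads_symm _ _ _ h, (neg_neg u).symm⟩

theorem mem_star (h : Γ.SameEdge z a v u) (R : Γ.IsReversible) (hu : u ∈ Γ.star v) :
    a ∈ Γ.star z := by
  rcases h with ⟨rfl, rfl⟩ | ⟨h, rfl⟩
  · exact hu
  · exact (R.heads_symm _ _ _ h).1

end SameEdge

namespace IsTropicalCurve

variable (h : Γ.IsTropicalCurve)
include h

theorem heads_symm (hw : Γ.HeadsTo v u w) : Γ.HeadsTo w (-u) v := by
  obtain ⟨u', hu'⟩ := h.adj_heads w v hw.2.1.symm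
  obtain ⟨t, ht, hwv⟩ := hw.2.2
  obtain ⟨t', ht', hvw⟩ := hu'.2.2
  have hback : t • latticeVec u = t' • latticeVec (-u') := by
    rw [latticeVec_neg, smul_neg]
    rw [hwv, add_assoc, left_eq_add] at hvw
    exact eq_neg_of_add_eq_zero_left hvw
  have hprim : IsCoprime (-u').1 (-u').2 := (h.primitive _ _ hu'.1).neg_neg
  rwa [eq_of_smul_latticeVec_eq (h.primitive _ _ hw.1) hprim ht ht' hback, neg_neg]

theorem heads_unique {w' : Fin Γ.n} (hw : Γ.HeadsTo v u w) (hw' : Γ.HeadsTo v u w') : w = w' := by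
  obtain ⟨s, hs, hws⟩ := hw.2.2
  obtain ⟨s', hs', hws'⟩ := hw'.2.2
  wlog hle : s ≤ s' generalizing w w' s s'
  · exact (this hw' hw s' hs' hws' s hs hws (le_of_not_ge hle)).symm
  by_contra hne
  have hlt : s < s' := hle.lt_of_ne fun heq => hne (h.pos_injective (by rw [hws, hws', heq]))
  refine h.vertex_notMem _ u (Or.inl ⟨v, w', hw', rfl⟩) w ?_
  rw [openSegment_eq_image']
  refine ⟨s / s', ⟨div_pos hs hs', (div_lt_one hs').2 hlt⟩, ?_⟩
  simp only [hws', hws, add_sub_cancel_left, smul_smul, div_mul_cancel₀ _ hs'.ne']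

theorem isReversible : Γ.IsReversible :=
  ⟨h.primitive, fun _ _ _ _ => h.heads_unique, fun _ _ _ => h.heads_symm⟩

theorem pos_notMem_openEdge (hu : u ∈ Γ.star v) (z : Fin Γ.n) : Γ.pos z ∉ Γ.openEdge v u :=
  h.vertex_notMem _ u (h.isReversible.isOpenEdge_iff.2 ⟨v, hu, rfl⟩) z

theorem exists_sameEdge_of_pos_mem_closedEdge {z : Fin Γ.n} (hu : u ∈ Γ.star v)
    (hz : Γ.pos z ∈ Γ.closedEdge v u) : ∃ a, Γ.SameEdge z a v u := by
  rcases h.isReversible.mem_closedEdge_cases hu hz with hopen | hv | ⟨w, hw, hzw⟩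
  · exact absurd hopen (h.pos_notMem_openEdge hu z)
  · exact ⟨u, Or.inl ⟨h.pos_injective hv, rfl⟩⟩
  · obtain rfl := h.pos_injective hzw
    exact ⟨-u, Or.inr ⟨hw, rfl⟩⟩

theorem closedEdge_eq_of_mem_openEdge {v' : Fin Γ.n} {u' : ℤ × ℤ} (hu : u ∈ Γ.star v)
    (hu' : u' ∈ Γ.star v') {x : Plane} (hx : x ∈ Γ.openEdge v u) (hx' : x ∈ Γ.openEdge v' u') :
    Γ.closedEdge v u = Γ.closedEdge v' u' := by
  have R := h.isReversible
  rw [← R.closure_openEdge hu, ← R.closure_openEdge hu', h.edge_disjoint _ u _ u'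
    (R.isOpenEdge_iff.2 ⟨v, hu, rfl⟩) (R.isOpenEdge_iff.2 ⟨v', hu', rfl⟩) ⟨x, hx, hx'⟩]

theorem exists_common_end {v' : Fin Γ.n} {u' : ℤ × ℤ} (hu : u ∈ Γ.star v) (hu' : u' ∈ Γ.star v')
    {x : Plane} (hx : x ∈ Γ.closedEdge v u) (hx' : x ∈ Γ.closedEdge v' u') :
    ∃ z a a', Γ.SameEdge z a v u ∧ Γ.SameEdge z a' v' u' := by
  have R := h.isReversible
  suffices hz : ∃ z, Γ.pos z ∈ Γ.closedEdge v u ∧ Γ.pos z ∈ Γ.closedEdge v' u' by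
    obtain ⟨z, hz, hz'⟩ := hz
    obtain ⟨a, ha⟩ := h.exists_sameEdge_of_pos_mem_closedEdge hu hz
    obtain ⟨a', ha'⟩ := h.exists_sameEdge_of_pos_mem_closedEdge hu' hz'
    exact ⟨z, a, a', ha, ha'⟩
  rcases R.mem_closedEdge_cases hu hx with hopen | rfl | ⟨w, -, rfl⟩
  · rcases R.mem_closedEdge_cases hu' hx' with hopen' | rfl | ⟨w, -, rfl⟩
    · refine ⟨v, R.pos_mem_closedEdge hu, ?_⟩
      rw [← h.closedEdge_eq_of_mem_openEdge hu hu' hopen hopen']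
      exact R.pos_mem_closedEdge hu
    exacts [⟨v', hx, hx'⟩, ⟨w, hx, hx'⟩]
  exacts [⟨v, hx, hx'⟩, ⟨w, hx, hx'⟩]

end IsTropicalCurve
end PlaneGraph

/-! ### Separation of disjoint edges -/

section Separation

open Metric Pointwise

theorem exists_disjoint_thickenings_of_isClosed_sub {E : Type*} [SeminormedAddCommGroup E]
    {A B : Set E} (hAB : Disjoint A B) (hclosed : IsClosed (A - B)) :
    ∃ r > 0, Disjoint (thickening r A) (thickening r B) := by
  have hzero : (A - B)ᶜ ∈ 𝓝 (0 : E) := by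
    refine hclosed.isOpen_compl.mem_nhds ?_
    rintro ⟨a, ha, b, hb, hab⟩
    exact Set.disjoint_left.1 hAB ha (sub_eq_zero.1 hab ▸ hb)
  obtain ⟨ε, hε, hball⟩ := Metric.mem_nhds_iff.1 hzero
  refine ⟨ε / 2, half_pos hε, Set.disjoint_left.2 fun x hxA hxB => ?_⟩
  obtain ⟨a, ha, hxa⟩ := mem_thickening_iff.1 hxA
  obtain ⟨b, hb, hxb⟩ := mem_thickening_iff.1 hxB
  refine hball ?_ (Set.sub_mem_sub ha hb)
  rw [mem_ball_zero_iff, ← dist_eq_norm]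
  linarith [dist_triangle_left a b x]

theorem segment_add_subset_thickening {E : Type*} [SeminormedAddCommGroup E] [NormedSpace ℝ E]
    {η : ℝ} {p q a b : E} (ha : ‖a‖ < η) (hb : ‖b‖ < η) :
    segment ℝ (p + a) (q + b) ⊆ thickening η (segment ℝ p q) := by
  rintro x ⟨s, t, hs, ht, hst, rfl⟩
  refine mem_thickening_iff.2 ⟨s • p + t • q, ⟨s, t, hs, ht, hst, rfl⟩, ?_⟩
  have hdiff : s • (p + a) + t • (q + b) - (s • p + t • q) = s • a + t • b := by module
  rw [dist_eq_norm, hdiff, ← mem_ball_zero_iff]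
  exact convex_ball 0 η (mem_ball_zero_iff.2 ha) (mem_ball_zero_iff.2 hb) hs ht hst

theorem image2_smul_add_smul_Ici_eq {p q : Plane} (hqp : planeDet q p ≠ 0) :
    Set.image2 (fun t s : ℝ => t • p + s • q) (Set.Ici 0) (Set.Ici 0) =
      {x | 0 ≤ planeDet q x / planeDet q p} ∩ {x | planeDet p x / planeDet q p ≤ 0} := by
  have hcoord : ∀ x : Plane, ∀ t s : ℝ, t • p + s • q = x ↔
      t = planeDet q x / planeDet q p ∧ -s = planeDet p x / planeDet q p := fun x t s => by
    rw [← sub_zero x, ← add_smul_eq_add_smul_iff hqp, zero_add, neg_smul, sub_zero,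
      ← sub_eq_add_neg, sub_eq_iff_eq_add, eq_comm]
  ext x
  constructor
  · rintro ⟨t, ht, s, hs, hx⟩
    obtain ⟨ht', hs'⟩ := (hcoord x t s).1 hx
    exact ⟨ht.out.trans_eq ht', hs'.symm.trans_le (neg_nonpos.2 hs)⟩
  · rintro ⟨ht, hs⟩
    exact ⟨_, ht, -(planeDet p x / planeDet q p), Set.mem_Ici.2 (neg_nonneg.2 hs),
      (hcoord x _ _).2 ⟨rfl, neg_neg _⟩⟩

theorem isClosed_ray_add_ray {p : Plane} (hp : p ≠ 0) (q : Plane) :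
    IsClosed ((fun t : ℝ => t • p) '' Set.Ici 0 + (fun t : ℝ => t • q) '' Set.Ici 0) := by
  rw [← Set.image2_add, Set.image2_image_left, Set.image2_image_right]
  by_cases hpq : planeDet p q = 0
  · obtain ⟨k, rfl⟩ := exists_smul_eq_of_planeDet_eq_zero hp hpq
    simp only [smul_smul, ← add_smul]
    rw [← Set.image_image2 (fun t s : ℝ => t + s * k) (fun r : ℝ => r • p)]
    refine (isClosedEmbedding_smul_left (𝕜 := ℝ) hp).isClosedMap _ ?_
    rcases le_or_gt 0 k with hk | hk
    · convert isClosed_Ici (a := (0 : ℝ))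
      refine Set.Subset.antisymm ?_ fun r hr => ⟨r, hr, 0, Set.self_mem_Ici, by simp⟩
      rintro _ ⟨t, ht, s, hs, rfl⟩
      exact add_nonneg ht (mul_nonneg hs hk)
    · convert isClosed_univ (X := ℝ)
      refine Set.eq_univ_of_forall fun r => ⟨|r|, abs_nonneg r, (r - |r|) / k,
        div_nonneg_of_nonpos (sub_nonpos.2 (le_abs_self r)) hk.le, ?_⟩
      simp only [div_mul_cancel₀ _ hk.ne, add_sub_cancel]
  · rw [image2_smul_add_smul_Ici_eq fun h => hpq (by rw [← neg_planeDet, h, neg_zero])]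
    exact (isClosed_le continuous_const (by fun_prop)).inter
      (isClosed_le (by fun_prop) continuous_const)

namespace PlaneGraph

variable {Γ : PlaneGraph} {v w v' : Fin Γ.n} {u u' : ℤ × ℤ}

theorem IsRay.closedEdge_eq (h : Γ.IsRay v u) :
    Γ.closedEdge v u = {Γ.pos v} + (fun t : ℝ => t • latticeVec u) '' Set.Ici 0 := by
  rw [closedEdge, h.reach_eq, Set.singleton_add, Set.image_image]

theorem IsReversible.isClosed_closedEdge_sub (R : Γ.IsReversible) (hu : u ∈ Γ.star v)
    (hu' : u' ∈ Γ.star v') : IsClosed (Γ.closedEdge v u - Γ.closedEdge v' u') := by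
  have hclosed := R.isClosed_closedEdge hu
  have hclosed' := R.isClosed_closedEdge hu'
  rw [sub_eq_add_neg]
  rcases exists_headsTo_or_isRay hu with ⟨w, h⟩ | hray
  · refine hclosed'.neg.add_left_of_isCompact ?_
    rw [R.closedEdge_eq_segment h, ← convexHull_pair]
    exact (Set.toFinite _).isCompact_convexHull (𝕜 := ℝ)
  rcases exists_headsTo_or_isRay hu' with ⟨w, h⟩ | hray'
  · refine hclosed.add_right_of_isCompact ?_
    rw [R.closedEdge_eq_segment h, ← convexHull_pair]
    exact ((Set.toFinite _).isCompact_convexHull ℝ).neg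
  · rw [hray.closedEdge_eq, hray'.closedEdge_eq, neg_add, add_add_add_comm]
    have hneg : -((fun t : ℝ => t • latticeVec u') '' Set.Ici 0) =
        (fun t : ℝ => t • -latticeVec u') '' Set.Ici 0 := by
      simp only [← Set.image_neg_eq_neg, Set.image_image, smul_neg]
    rw [hneg]
    exact (isClosed_ray_add_ray (R.latticeVec_ne_zero hu) _).add_left_of_isCompact
      (isCompact_singleton.add isCompact_singleton.neg)

/-- A length `η` below which displacements are small compared to the features of the drawing:
distinct vertices are far apart, and edges that do not meet stay apart. -/
structure IsSmallScale (Γ : PlaneGraph) (η : ℝ) : Prop where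
  pos : 0 < η
  four_mul_le_dist : ∀ v w, v ≠ w → 4 * η ≤ ‖Γ.pos w - Γ.pos v‖
  disjoint_thickening : ∀ v v', ∀ u ∈ Γ.star v, ∀ u' ∈ Γ.star v',
    Disjoint (Γ.closedEdge v u) (Γ.closedEdge v' u') →
      Disjoint (thickening η (Γ.closedEdge v u)) (thickening η (Γ.closedEdge v' u'))

theorem IsTropicalCurve.exists_isSmallScale (h : Γ.IsTropicalCurve) :
    ∃ η, Γ.IsSmallScale η := by
  have hvertex : ∀ᶠ η : ℝ in 𝓝[>] 0, ∀ v w, v ≠ w → 4 * η ≤ ‖Γ.pos w - Γ.pos v‖ := by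
    simp only [eventually_all]
    intro v w hne
    have hdist : 0 < ‖Γ.pos w - Γ.pos v‖ :=
      norm_pos_iff.2 (sub_ne_zero.2 (h.pos_injective.ne hne.symm))
    filter_upwards [Ioo_mem_nhdsGT (div_pos hdist four_pos)] with η hη
    linarith [hη.2]
  have hedge : ∀ᶠ η : ℝ in 𝓝[>] 0, ∀ v v', ∀ u ∈ Γ.star v, ∀ u' ∈ Γ.star v',
      Disjoint (Γ.closedEdge v u) (Γ.closedEdge v' u') →
        Disjoint (thickening η (Γ.closedEdge v u)) (thickening η (Γ.closedEdge v' u')) := by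
    simp only [eventually_all, eventually_all_finset]
    intro v v' u hu u' hu' hd
    obtain ⟨r, hr, hdis⟩ := exists_disjoint_thickenings_of_isClosed_sub hd
      (h.isReversible.isClosed_closedEdge_sub hu hu')
    filter_upwards [Ioo_mem_nhdsGT hr] with η hη
    exact hdis.mono (thickening_mono hη.2.le _) (thickening_mono hη.2.le _)
  obtain ⟨η, hpos, hη⟩ := (eventually_mem_nhdsWithin.and (hvertex.and hedge)).exists
  exact ⟨η, hpos, hη.1, hη.2⟩

theorem IsTropicalCurve.exists_common_end_of_mem_thickening (h : Γ.IsTropicalCurve) {η : ℝ}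
    (hη : Γ.IsSmallScale η) (hu : u ∈ Γ.star v) (hu' : u' ∈ Γ.star v') {x : Plane}
    (hx : x ∈ thickening η (Γ.closedEdge v u)) (hx' : x ∈ thickening η (Γ.closedEdge v' u')) :
    ∃ z a a', Γ.SameEdge z a v u ∧ Γ.SameEdge z a' v' u' := by
  by_contra hno
  refine Set.disjoint_left.1 (hη.disjoint_thickening v v' u hu u' hu' ?_) hx hx'
  exact Set.disjoint_left.2 fun y hy hy' => hno (h.exists_common_end hu hu' hy hy')

end PlaneGraph

end Separation

/-! ### Slope-preserving displacements -/

namespace PlaneGraph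

/-- The graph `Γ` with each vertex `v` displaced by `δ v`. -/
def deform (Γ : PlaneGraph) (δ : Fin Γ.n → Plane) : PlaneGraph where
  n := Γ.n
  pos := fun v => Γ.pos v + δ v
  graph := Γ.graph
  star := Γ.star

/-- The first-order change of slope of each bounded edge under a displacement of the vertices. -/
def slopeDefect (Γ : PlaneGraph) : (Fin Γ.n → Plane) →ₗ[ℝ] (Γ.graph.edgeSet → ℝ) where
  toFun δ e := Sym2.lift ⟨fun v w => planeDet (Γ.pos w - Γ.pos v) (δ w - δ v), fun v w => by
    simp only [map_sub, LinearMap.sub_apply]; ring⟩ e.1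
  map_add' δ δ' := by
    ext ⟨⟨v, w⟩, _⟩
    change planeDet _ (δ w + δ' w - (δ v + δ' v)) = planeDet _ _ + planeDet _ _
    rw [add_sub_add_comm, map_add]
  map_smul' r δ := by
    ext ⟨⟨v, w⟩, _⟩
    change planeDet _ (r • δ w - r • δ v) = r • planeDet _ _
    rw [← smul_sub, map_smul]

/-- The displacements of the vertices that preserve the slopes of the bounded edges. -/
def slopeSpace (Γ : PlaneGraph) : Submodule ℝ (Fin Γ.n → Plane) :=
  LinearMap.ker Γ.slopeDefect

variable {Γ : PlaneGraph} {v w v' : Fin Γ.n} {u u' : ℤ × ℤ} {δ : Fin Γ.n → Plane}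

theorem mem_slopeSpace_iff : δ ∈ Γ.slopeSpace ↔
    ∀ v w, Γ.graph.Adj v w → planeDet (Γ.pos w - Γ.pos v) (δ w - δ v) = 0 := by
  rw [slopeSpace, LinearMap.mem_ker, funext_iff, Subtype.forall, Sym2.forall]
  rfl

theorem const_mem_slopeSpace (c : Plane) : (fun _ => c) ∈ Γ.slopeSpace :=
  mem_slopeSpace_iff.2 fun v w _ => by rw [sub_self, map_zero]

theorem two_mul_le_finrank_slopeSpace_add_card_edgeSet :
    2 * Γ.n ≤ Module.finrank ℝ Γ.slopeSpace + Nat.card Γ.graph.edgeSet := by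
  have hrank := LinearMap.finrank_range_add_finrank_ker Γ.slopeDefect
  have hrange := Submodule.finrank_le (LinearMap.range Γ.slopeDefect)
  have hsource : Module.finrank ℝ (Fin Γ.n → Plane) = 2 * Γ.n := by
    rw [Module.finrank_pi_fintype]
    simp [mul_comm]
  have htarget : Module.finrank ℝ (Γ.graph.edgeSet → ℝ) = Nat.card Γ.graph.edgeSet := by
    have := Fintype.ofFinite Γ.graph.edgeSet
    rw [Module.finrank_fintype_fun_eq_card, Nat.card_eq_fintype_card]
  rw [slopeSpace]
  lia

theorem planeDet_eq_of_headsTo (hδ : δ ∈ Γ.slopeSpace) (hw : Γ.HeadsTo v u w) :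
    planeDet (latticeVec u) (δ w) = planeDet (latticeVec u) (δ v) := by
  obtain ⟨t, ht, hpos⟩ := hw.2.2
  have hzero := mem_slopeSpace_iff.1 hδ v w hw.2.1
  rw [hpos, add_sub_cancel_left, map_smul, LinearMap.smul_apply, smul_eq_mul] at hzero
  rw [← sub_eq_zero, ← map_sub]
  exact (mul_eq_zero.1 hzero).resolve_left ht.ne'

/-- A displacement that preserves slopes and is small compared to the features of the drawing. -/
structure IsSmallDeformation (Γ : PlaneGraph) (η : ℝ) (δ : Fin Γ.n → Plane) : Prop where
  isSmallScale : Γ.IsSmallScale η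
  mem_slopeSpace : δ ∈ Γ.slopeSpace
  norm_lt : ‖δ‖ < η

namespace IsSmallDeformation

variable {η : ℝ} (D : Γ.IsSmallDeformation η δ)
include D

theorem norm_apply_lt (v : Fin Γ.n) : ‖δ v‖ < η :=
  (norm_le_pi_norm δ v).trans_lt D.norm_lt

theorem norm_sub_lt (hne : v ≠ w) : ‖δ w - δ v‖ < ‖Γ.pos w - Γ.pos v‖ := by
  linarith [D.isSmallScale.four_mul_le_dist v w hne, norm_sub_le (δ w) (δ v),
    D.norm_apply_lt v, D.norm_apply_lt w, D.isSmallScale.pos]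

theorem pos_injective : Function.Injective (Γ.deform δ).pos := by
  intro v w hvw
  by_contra hne
  refine (D.norm_sub_lt hne).ne' ?_
  rw [← norm_neg (δ w - δ v), neg_sub]
  have hpos : Γ.pos v + δ v = Γ.pos w + δ w := hvw
  congr 1
  rw [sub_eq_sub_iff_add_eq_add, ← hpos, add_comm]

theorem exists_length (h : Γ.IsTropicalCurve) (hw : Γ.HeadsTo v u w) :
    ∃ s : ℝ, 0 < s ∧ (Γ.deform δ).pos w = (Γ.deform δ).pos v + s • latticeVec u := by
  have hu := h.isReversible.latticeVec_ne_zero hw.1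
  obtain ⟨t, ht, hpos⟩ := hw.2.2
  have hparallel : planeDet (latticeVec u) (δ w - δ v) = 0 := by
    rw [map_sub, planeDet_eq_of_headsTo D.mem_slopeSpace hw, sub_self]
  obtain ⟨s, hs⟩ := exists_smul_eq_of_planeDet_eq_zero hu hparallel
  have hlt : |s| < t := by
    have hnorm := D.norm_sub_lt hw.2.1.ne
    rw [← hs, hpos, add_sub_cancel_left, norm_smul, norm_smul, Real.norm_of_nonneg ht.le] at hnorm
    exact lt_of_mul_lt_mul_right hnorm (norm_nonneg _)
  refine ⟨t + s, by linarith [neg_abs_le s], ?_⟩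
  change Γ.pos w + δ w = Γ.pos v + δ v + (t + s) • latticeVec u
  rw [add_smul, hs, hpos]
  abel

theorem headsTo_iff (h : Γ.IsTropicalCurve) : (Γ.deform δ).HeadsTo v u w ↔ Γ.HeadsTo v u w := by
  refine ⟨fun ⟨hu, hadj, t, ht, hw⟩ => ?_, fun hw => ⟨hw.1, hw.2.1, D.exists_length h hw⟩⟩
  obtain ⟨u₀, hu₀⟩ := h.adj_heads v w hadj
  obtain ⟨s, hs, hws⟩ := D.exists_length h hu₀
  rwa [eq_of_smul_latticeVec_eq (h.primitive v u hu) (h.primitive v u₀ hu₀.1) ht hs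
    (add_left_cancel (hw.symm.trans hws))]

theorem isReversible (h : Γ.IsTropicalCurve) : (Γ.deform δ).IsReversible where
  primitive := h.primitive
  heads_unique _ _ _ _ hw hw' :=
    h.heads_unique ((D.headsTo_iff h).1 hw) ((D.headsTo_iff h).1 hw')
  heads_symm _ _ _ hw := (D.headsTo_iff h).2 (h.heads_symm ((D.headsTo_iff h).1 hw))

theorem sameEdge {z : Fin Γ.n} {a : ℤ × ℤ} (h : Γ.IsTropicalCurve) (hz : Γ.SameEdge z a v u) :
    (Γ.deform δ).SameEdge z a v u :=
  hz.imp_right (And.imp_left (D.headsTo_iff h).2)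

theorem closedEdge_subset_thickening (h : Γ.IsTropicalCurve) (hu : u ∈ Γ.star v) :
    (Γ.deform δ).closedEdge v u ⊆ Metric.thickening η (Γ.closedEdge v u) := by
  rcases exists_headsTo_or_isRay hu with ⟨w, hw⟩ | hray
  · rw [(D.isReversible h).closedEdge_eq_segment ((D.headsTo_iff h).2 hw),
      h.isReversible.closedEdge_eq_segment hw]
    exact segment_add_subset_thickening (D.norm_apply_lt v) (D.norm_apply_lt w)
  · rintro _ ⟨t, ht, rfl⟩
    refine Metric.mem_thickening_iff.2 ⟨Γ.pos v + t • latticeVec u, ⟨t, ?_, rfl⟩, ?_⟩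
    · rw [hray.reach_eq]
      exact ht.1
    · change dist (Γ.pos v + δ v + t • latticeVec u) _ < η
      rw [dist_eq_norm, add_sub_add_right_eq_sub, add_sub_cancel_left]
      exact D.norm_apply_lt v

theorem exists_common_end (h : Γ.IsTropicalCurve) (hu : u ∈ Γ.star v) (hu' : u' ∈ Γ.star v')
    {x : Plane} (hx : x ∈ (Γ.deform δ).closedEdge v u)
    (hx' : x ∈ (Γ.deform δ).closedEdge v' u') :
    ∃ z, ∃ a ∈ Γ.star z, ∃ a' ∈ Γ.star z,
      (Γ.deform δ).SameEdge z a v u ∧ (Γ.deform δ).SameEdge z a' v' u' := by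
  obtain ⟨z, a, a', hz, hz'⟩ := h.exists_common_end_of_mem_thickening D.isSmallScale hu hu'
    (D.closedEdge_subset_thickening h hu hx) (D.closedEdge_subset_thickening h hu' hx')
  exact ⟨z, a, hz.mem_star h.isReversible hu, a', hz'.mem_star h.isReversible hu',
    D.sameEdge h hz, D.sameEdge h hz'⟩

theorem vertex_notMem (h : Γ.IsTropicalCurve) (hu : u ∈ Γ.star v) (w : Fin Γ.n) :
    (Γ.deform δ).pos w ∉ (Γ.deform δ).openEdge v u := by
  intro hw
  have R := D.isReversible h
  obtain ⟨u₀, hu₀⟩ := h.star_nonempty w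
  obtain ⟨z, a, ha, a', ha', hz, hz'⟩ := D.exists_common_end h hu hu₀
    (openEdge_subset_closedEdge hw) (R.pos_mem_closedEdge hu₀)
  rw [← hz.openEdge_eq R] at hw
  by_cases haa : a = a'
  · subst haa
    rcases hz' with ⟨rfl, -⟩ | ⟨hwz, rfl⟩
    · exact R.pos_notMem_openEdge ha hw
    · exact R.pos_notMem_openEdge_of_headsTo (R.heads_symm _ _ _ hwz) hw
  · have hpos := R.eq_pos_of_mem_closedEdge ha ha' haa (openEdge_subset_closedEdge hw)
      (hz'.closedEdge_eq R ▸ R.pos_mem_closedEdge hu₀)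
    rw [hpos] at hw
    exact R.pos_notMem_openEdge ha hw

theorem edge_disjoint (h : Γ.IsTropicalCurve) (hu : u ∈ Γ.star v) (hu' : u' ∈ Γ.star v')
    {x : Plane} (hx : x ∈ (Γ.deform δ).openEdge v u) (hx' : x ∈ (Γ.deform δ).openEdge v' u') :
    (Γ.deform δ).openEdge v u = (Γ.deform δ).openEdge v' u' := by
  have R := D.isReversible h
  obtain ⟨z, a, ha, a', ha', hz, hz'⟩ := D.exists_common_end h hu hu'
    (openEdge_subset_closedEdge hx) (openEdge_subset_closedEdge hx')
  rw [← hz.openEdge_eq R] at hx ⊢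
  rw [← hz'.openEdge_eq R] at hx' ⊢
  by_contra hne
  have haa : a ≠ a' := fun heq => hne (heq ▸ rfl)
  refine R.pos_notMem_openEdge ha ?_
  rwa [← R.eq_pos_of_mem_closedEdge ha ha' haa (openEdge_subset_closedEdge hx)
    (openEdge_subset_closedEdge hx')]

theorem isTropicalCurve (h : Γ.IsTropicalCurve) : (Γ.deform δ).IsTropicalCurve where
  nonempty := h.nonempty
  pos_injective := D.pos_injective
  star_nonempty := h.star_nonempty
  primitive := h.primitive
  adj_heads v w hvw := (h.adj_heads v w hvw).imp fun _ => (D.headsTo_iff h).2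
  vertex_notMem e u he w := by
    obtain ⟨v, hu, rfl⟩ := (D.isReversible h).isOpenEdge_iff.1 he
    exact D.vertex_notMem h hu w
  edge_disjoint e u e' u' he he' := by
    rintro ⟨x, hx, hx'⟩
    obtain ⟨v, hu, rfl⟩ := (D.isReversible h).isOpenEdge_iff.1 he
    obtain ⟨v', hu', rfl⟩ := (D.isReversible h).isOpenEdge_iff.1 he'
    exact D.edge_disjoint h hu hu' hx hx'
  balanced := h.balanced

theorem sameSubdividedDualPolygon (h : Γ.IsTropicalCurve) :
    Γ.SameSubdividedDualPolygon (Γ.deform δ) := by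
  have hplacement (P : Fin Γ.n → Set Plane) :
      Γ.IsDualPlacement P ↔ (Γ.deform δ).IsDualPlacement P :=
    and_congr Iff.rfl (forall₃_congr fun _ _ _ => imp_congr (D.headsTo_iff h).symm Iff.rfl)
  ext S
  exact exists_congr fun P => and_congr (hplacement P) Iff.rfl

end IsSmallDeformation

theorem SameSubdividedDualPolygon.sameDualPolygon {Γ' : PlaneGraph}
    (h : Γ.SameSubdividedDualPolygon Γ') : Γ.SameDualPolygon Γ' := by
  rw [SameDualPolygon, dualPolygons, h, dualPolygons]

end PlaneGraph

/-! ### Tripods -/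

theorem exists_opposite_sign {x y z : ℝ} (hx : x ≠ 0) (hy : y ≠ 0) (hz : z ≠ 0)
    (hsum : x + y + z = 0) :
    (x * y < 0 ∧ x * z < 0) ∨ (y * z < 0 ∧ y * x < 0) ∨ (z * x < 0 ∧ z * y < 0) := by
  simp only [mul_neg_iff]
  grind

/-- Three directions with sum zero, any two of which span the lattice, named so that `c` lies in
the open cone spanned by `I` and `I + J`. -/
structure Tripod (c : Plane) where
  I : ℤ × ℤ
  J : ℤ × ℤ
  K : ℤ × ℤ
  add_eq_zero : I + J + K = 0
  abs_det : |latticeDet I J| = 1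
  cone : ∃ a b : ℝ, 0 < a ∧ a < b ∧ c = a • latticeVec I + b • latticeVec J

namespace Tripod

variable {c : Plane} (T : Tripod c)

/-- The set of all three directions of a tripod. -/
def star : Finset (ℤ × ℤ) := {T.I, T.J, T.K}

/-- The two directions of a tripod whose cone contains `c`. -/
def arms : Finset (ℤ × ℤ) := {T.I, T.J}

theorem J_mem_star : T.J ∈ T.star := by simp [star]

theorem K_mem_star : T.K ∈ T.star := by simp [star]

theorem arms_subset_star : T.arms ⊆ T.star := by
  simp [arms, star, Finset.insert_subset_iff]

theorem I_mem_arms : T.I ∈ T.arms := by simp [arms]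

theorem J_mem_arms : T.J ∈ T.arms := by simp [arms]

theorem mem_arms_or_eq_K {u : ℤ × ℤ} (hu : u ∈ T.star) : u ∈ T.arms ∨ u = T.K := by
  simpa [arms, star, or_assoc] using hu

theorem latticeVec_K : latticeVec T.K = -(latticeVec T.I + latticeVec T.J) := by
  rw [← latticeVec_add, ← latticeVec_neg, eq_neg_of_add_eq_zero_right T.add_eq_zero]

theorem planeDet_I_J_ne_zero : planeDet (latticeVec T.I) (latticeVec T.J) ≠ 0 := by
  rw [planeDet_latticeVec, Int.cast_ne_zero, ← abs_ne_zero, T.abs_det]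
  exact one_ne_zero

theorem latticeVec_J_ne_zero : latticeVec T.J ≠ 0 := fun h =>
  T.planeDet_I_J_ne_zero (by rw [h, map_zero])

theorem planeDet_I_K :
    planeDet (latticeVec T.I) (latticeVec T.K) = -planeDet (latticeVec T.I) (latticeVec T.J) := by
  rw [T.latticeVec_K, map_neg, map_add, planeDet_self, zero_add]

theorem planeDet_J_K :
    planeDet (latticeVec T.J) (latticeVec T.K) = planeDet (latticeVec T.I) (latticeVec T.J) := by
  rw [T.latticeVec_K, map_neg, map_add, planeDet_self, add_zero, neg_planeDet]

theorem abs_latticeDet_J_K : |latticeDet T.J T.K| = 1 := by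
  rw [← T.abs_det, eq_neg_of_add_eq_zero_right T.add_eq_zero]
  congr 1
  simp only [latticeDet, Prod.fst_neg, Prod.snd_neg, Prod.fst_add, Prod.snd_add]
  ring

/-- The `I`-coordinate of a vector in the basis `I, J`. -/
def coordI : Plane →ₗ[ℝ] ℝ :=
  -(planeDet (latticeVec T.I) (latticeVec T.J))⁻¹ • planeDet (latticeVec T.J)

/-- The excess of the `J`-coordinate over the `I`-coordinate of a vector in the basis `I, J`. -/
def gap : Plane →ₗ[ℝ] ℝ :=
  -(planeDet (latticeVec T.I) (latticeVec T.J))⁻¹ • planeDet (latticeVec T.K)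

theorem coordI_apply (x : Plane) :
    T.coordI x =
      -(planeDet (latticeVec T.I) (latticeVec T.J))⁻¹ * planeDet (latticeVec T.J) x := rfl

theorem gap_apply (x : Plane) :
    T.gap x =
      -(planeDet (latticeVec T.I) (latticeVec T.J))⁻¹ * planeDet (latticeVec T.K) x := rfl

theorem coordI_I : T.coordI (latticeVec T.I) = 1 := by
  rw [coordI_apply, ← neg_planeDet (latticeVec T.I), neg_mul_neg,
    inv_mul_cancel₀ T.planeDet_I_J_ne_zero]

theorem coordI_J : T.coordI (latticeVec T.J) = 0 := by
  rw [coordI_apply, planeDet_self, mul_zero]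

theorem coordI_K : T.coordI (latticeVec T.K) = -1 := by
  rw [T.latticeVec_K, map_neg, map_add, T.coordI_I, T.coordI_J, add_zero]

theorem gap_K : T.gap (latticeVec T.K) = 0 := by
  rw [gap_apply, planeDet_self, mul_zero]

theorem gap_J : T.gap (latticeVec T.J) = 1 := by
  rw [gap_apply, T.latticeVec_K, map_neg, map_add, LinearMap.neg_apply, LinearMap.add_apply,
    planeDet_self, add_zero, neg_mul_neg, inv_mul_cancel₀ T.planeDet_I_J_ne_zero]

theorem gap_I : T.gap (latticeVec T.I) = -1 := by
  have hsum := T.gap_K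
  rw [T.latticeVec_K, map_neg, map_add, T.gap_J, neg_eq_zero] at hsum
  exact eq_neg_of_add_eq_zero_left hsum

theorem gap_eq_zero_iff {x : Plane} : T.gap x = 0 ↔ planeDet (latticeVec T.K) x = 0 := by
  rw [gap_apply, mul_eq_zero_iff_left (neg_ne_zero.2 (inv_ne_zero T.planeDet_I_J_ne_zero))]

theorem coordI_pos : 0 < T.coordI c := by
  obtain ⟨a, b, ha, -, hc⟩ := T.cone
  have hcoordI := congrArg T.coordI hc
  rw [map_add, map_smul, map_smul, T.coordI_I, T.coordI_J, smul_eq_mul, smul_eq_mul] at hcoordI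
  linarith

theorem gap_pos : 0 < T.gap c := by
  obtain ⟨a, b, -, hab, hc⟩ := T.cone
  have hgap := congrArg T.gap hc
  rw [map_add, map_smul, map_smul, T.gap_I, T.gap_J, smul_eq_mul, smul_eq_mul] at hgap
  linarith

theorem gap_smul_J (x : Plane) :
    T.gap x • latticeVec T.J = x + T.coordI x • latticeVec T.K := by
  have hdet := T.planeDet_I_J_ne_zero
  have hcramer := planeDet_smul_eq_add (latticeVec T.J) (latticeVec T.K) x
  rw [T.planeDet_J_K, ← neg_planeDet (latticeVec T.K) x, ← eq_inv_smul_iff₀ hdet] at hcramer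
  rw [T.coordI_apply, T.gap_apply]
  nth_rewrite 2 [hcramer]
  module

theorem planeDet_ne_zero_of_gap_eq_zero {x : Plane} (hgap : T.gap x = 0) (hx : x ≠ 0)
    {u : ℤ × ℤ} (hu : u ∈ T.arms) : planeDet (latticeVec u) x ≠ 0 := by
  have hmul : x = -T.coordI x • latticeVec T.K := by
    rw [neg_smul, ← zero_sub, eq_sub_iff_add_eq, ← T.gap_smul_J, hgap, zero_smul]
  simp only [arms, Finset.mem_insert, Finset.mem_singleton] at hu
  rw [hmul] at hx ⊢
  rw [map_smul, smul_eq_mul]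
  refine mul_ne_zero (left_ne_zero_of_smul hx) ?_
  rcases hu with rfl | rfl
  · exact T.planeDet_I_K ▸ neg_ne_zero.2 T.planeDet_I_J_ne_zero
  · exact T.planeDet_J_K ▸ T.planeDet_I_J_ne_zero

theorem eq_J_and_eq_gap_of_meet {x : Plane} (hcoordI : 0 < T.coordI x) (hgap : 0 < T.gap x)
    {a a' : ℤ × ℤ} (ha : a ∈ T.star) (ha' : a' ∈ T.star) {t t' : ℝ} (ht : 0 ≤ t) (ht' : 0 ≤ t')
    (hmeet : t • latticeVec a = x + t' • latticeVec a') : a = T.J ∧ t = T.gap x := by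
  have hI := congrArg T.coordI hmeet
  have hg := congrArg T.gap hmeet
  simp only [map_add, map_smul, smul_eq_mul] at hI hg
  simp only [star, Finset.mem_insert, Finset.mem_singleton] at ha ha'
  rcases ha with rfl | rfl | rfl <;> rcases ha' with rfl | rfl | rfl <;>
    simp only [T.coordI_I, T.coordI_J, T.coordI_K, T.gap_I, T.gap_J, T.gap_K] at hI hg <;>
    first
    | exact ⟨rfl, by linarith⟩
    | (exfalso; linarith)

theorem planeDet_I_mul_planeDet_J_neg :
    planeDet c (latticeVec T.I) * planeDet c (latticeVec T.J) < 0 := by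
  obtain ⟨a, b, ha, hab, hc⟩ := T.cone
  have hI : planeDet c (latticeVec T.I) = -(b * planeDet (latticeVec T.I) (latticeVec T.J)) := by
    simp only [hc, map_add, map_smul, LinearMap.add_apply, LinearMap.smul_apply, planeDet_self,
      ← neg_planeDet (latticeVec T.I) (latticeVec T.J), smul_eq_mul]
    ring
  have hJ : planeDet c (latticeVec T.J) = a * planeDet (latticeVec T.I) (latticeVec T.J) := by
    simp only [hc, map_add, map_smul, LinearMap.add_apply, LinearMap.smul_apply, planeDet_self,
      smul_eq_mul]
    ring
  rw [hI, hJ, neg_mul, neg_neg_iff_pos, mul_mul_mul_comm]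
  exact mul_pos (mul_pos (ha.trans hab) ha) (mul_self_pos.2 T.planeDet_I_J_ne_zero)

theorem planeDet_ne_zero_of_mem_arms {u : ℤ × ℤ} (hu : u ∈ T.arms) :
    planeDet c (latticeVec u) ≠ 0 := by
  simp only [arms, Finset.mem_insert, Finset.mem_singleton] at hu
  rcases hu with rfl | rfl
  · exact left_ne_zero_of_mul T.planeDet_I_mul_planeDet_J_neg.ne
  · exact right_ne_zero_of_mul T.planeDet_I_mul_planeDet_J_neg.ne

theorem exists_star_eq_of_pos {i j k : ℤ × ℤ} (hsum : i + j + k = 0)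
    (hdet : |latticeDet i j| = 1)
    (hi : 0 < planeDet (latticeVec i) (latticeVec j) * planeDet (latticeVec i) c)
    (hj : planeDet (latticeVec i) c * planeDet (latticeVec j) c < 0)
    (hk : planeDet (latticeVec i) c * planeDet (latticeVec k) c < 0) :
    ∃ T : Tripod c, T.star = {i, j, k} := by
  have hij : planeDet (latticeVec i) (latticeVec j) ≠ 0 := left_ne_zero_of_mul hi.ne'
  have hcramer := planeDet_smul_eq_add (latticeVec i) (latticeVec j) c
  rw [← neg_planeDet (latticeVec j) c, ← eq_inv_smul_iff₀ hij] at hcramer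
  have hsumc : planeDet (latticeVec k) c =
      -(planeDet (latticeVec i) c + planeDet (latticeVec j) c) := by
    rw [eq_neg_of_add_eq_zero_right hsum, latticeVec_neg, latticeVec_add, map_neg, map_add,
      LinearMap.neg_apply, LinearMap.add_apply]
  obtain ⟨ha, hab⟩ : 0 < -planeDet (latticeVec j) c / planeDet (latticeVec i) (latticeVec j) ∧
      -planeDet (latticeVec j) c / planeDet (latticeVec i) (latticeVec j) <
        planeDet (latticeVec i) c / planeDet (latticeVec i) (latticeVec j) := by
    rcases pos_and_pos_or_neg_and_neg_of_mul_pos hi with ⟨hd, hf⟩ | ⟨hd, hf⟩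
    · have hjneg := neg_of_mul_neg_right hj hf.le
      have hkneg := neg_of_mul_neg_right hk hf.le
      exact ⟨div_pos (neg_pos.2 hjneg) hd, div_lt_div_of_pos_right (by linarith) hd⟩
    · have hjpos := pos_of_mul_neg_right hj hf.le
      have hkpos := pos_of_mul_neg_right hk hf.le
      exact ⟨div_pos_of_neg_of_neg (neg_neg_of_pos hjpos) hd,
        (div_lt_div_right_of_neg hd).2 (by linarith)⟩
  refine ⟨⟨i, j, k, hsum, hdet, _, _, ha, hab, ?_⟩, rfl⟩
  nth_rewrite 1 [hcramer]
  module

theorem exists_star_eq_of_mul_neg {i j k : ℤ × ℤ} (hsum : i + j + k = 0)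
    (hdet : |latticeDet i j| = 1)
    (hj : planeDet (latticeVec i) c * planeDet (latticeVec j) c < 0)
    (hk : planeDet (latticeVec i) c * planeDet (latticeVec k) c < 0) :
    ∃ T : Tripod c, T.star = {i, j, k} := by
  rcases le_or_gt (planeDet (latticeVec i) (latticeVec j) * planeDet (latticeVec i) c) 0 with
    hneg | hpos
  · have hswap : latticeDet i k = -latticeDet i j := by
      rw [eq_neg_of_add_eq_zero_right hsum]
      simp only [latticeDet, Prod.fst_neg, Prod.snd_neg, Prod.fst_add, Prod.snd_add]
      ring
    have hne : latticeDet i j ≠ 0 := abs_ne_zero.1 (hdet ▸ one_ne_zero)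
    rw [Finset.pair_comm j k]
    refine exists_star_eq_of_pos (by rw [← hsum, add_right_comm]) (by rwa [hswap, abs_neg]) ?_ hk hj
    rw [planeDet_latticeVec, hswap, Int.cast_neg, neg_mul, neg_pos, ← planeDet_latticeVec]
    refine hneg.lt_of_ne (mul_ne_zero ?_ (left_ne_zero_of_mul hj.ne))
    rwa [planeDet_latticeVec, Int.cast_ne_zero]
  · exact exists_star_eq_of_pos hsum hdet hpos hj hk

theorem exists_star_eq {s : Finset (ℤ × ℤ)} (hcard : s.card = 3)
    (hdet : ∀ u ∈ s, ∀ u' ∈ s, u ≠ u' → |latticeDet u u'| = 1) (hsum : ∑ u ∈ s, u = 0)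
    (hc : ∀ u ∈ s, planeDet (latticeVec u) c ≠ 0) : ∃ T : Tripod c, T.star = s := by
  obtain ⟨i, j, k, hij, hik, hjk, rfl⟩ := Finset.card_eq_three.1 hcard
  rw [Finset.sum_insert (by simp [hij, hik]), Finset.sum_pair hjk, ← add_assoc] at hsum
  simp only [Finset.mem_insert, Finset.mem_singleton, forall_eq_or_imp, forall_eq] at hc hdet
  have hsumc : planeDet (latticeVec i) c + planeDet (latticeVec j) c + planeDet (latticeVec k) c
      = 0 := by
    rw [← LinearMap.add_apply, ← LinearMap.add_apply, ← map_add, ← map_add, ← latticeVec_add,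
      ← latticeVec_add, hsum]
    simp [planeDet_apply, latticeVec]
  rcases exists_opposite_sign hc.1 hc.2.1 hc.2.2 hsumc with ⟨h, h'⟩ | ⟨h, h'⟩ | ⟨h, h'⟩
  · exact exists_star_eq_of_mul_neg hsum (hdet.1.2.1 hij) h h'
  · obtain ⟨T, hT⟩ := exists_star_eq_of_mul_neg (by rw [← hsum]; abel) (hdet.2.1.2.2 hjk) h h'
    exact ⟨T, by rw [hT]; grind⟩
  · obtain ⟨T, hT⟩ := exists_star_eq_of_mul_neg (by rw [← hsum]; abel) (hdet.2.2.1 hik.symm) h h'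
    exact ⟨T, by rw [hT]; grind⟩

end Tripod

namespace PlaneGraph

variable {Γ : PlaneGraph} {c : Plane}

/-- A choice of a tripod for each vertex, whose directions are those of the edges at the vertex. -/
structure TripodLabelling (Γ : PlaneGraph) (c : Plane) where
  tripod : Fin Γ.n → Tripod c
  star_eq : ∀ v, Γ.star v = (tripod v).star

theorem IsSmooth.nonempty_tripodLabelling (hs : Γ.IsSmooth) (h : Γ.IsTropicalCurve)
    (hc : ∀ v, ∀ u ∈ Γ.star v, planeDet (latticeVec u) c ≠ 0) :
    Nonempty (Γ.TripodLabelling c) := by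
  choose T hT using fun v => Tripod.exists_star_eq (hs v).1 (hs v).2 (h.balanced v) (hc v)
  exact ⟨⟨T, fun v => (hT v).symm⟩⟩

end PlaneGraph

/-! ### Strands -/

theorem setOf_exists_add_smul_mem_image_line {c u : Plane} (h : planeDet c u ≠ 0) (p : Plane)
    (S R : Set ℝ) :
    {x | ∃ τ ∈ R, x + τ • c ∈ (fun t : ℝ => p + t • u) '' S} =
      (fun x => (planeDet c (x - p) / planeDet c u, planeDet u (x - p) / planeDet c u)) ⁻¹'
        S ×ˢ R := by
  ext x
  constructor
  · rintro ⟨τ, hτ, t, ht, hx⟩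
    obtain ⟨rfl, rfl⟩ := (add_smul_eq_add_smul_iff h).1 hx.symm
    exact ⟨ht, hτ⟩
  · rintro ⟨ht, hτ⟩
    exact ⟨_, hτ, _, ht, ((add_smul_eq_add_smul_iff h).2 ⟨rfl, rfl⟩).symm⟩

namespace PlaneGraph.TripodLabelling

variable {Γ : PlaneGraph} {c : Plane} (L : Γ.TripodLabelling c)

/-- A set of vertices that is closed under following arms, every arm being an arm at both of its
ends. -/
def IsStrand (A : Set (Fin Γ.n)) : Prop :=
  ∀ v ∈ A, ∀ u ∈ (L.tripod v).arms, ∀ w, Γ.HeadsTo v u w → w ∈ A ∧ -u ∈ (L.tripod w).arms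

/-- The union of the arms at the vertices in `A`. -/
def curve (A : Set (Fin Γ.n)) : Set Plane :=
  ⋃ v ∈ A, ⋃ u ∈ (L.tripod v).arms, Γ.closedEdge v u

/-- The points from which one meets the curve of `A` when moving in direction `c`. -/
def below (A : Set (Fin Γ.n)) : Set Plane :=
  {x | ∃ τ ∈ Set.Ici (0 : ℝ), x + τ • c ∈ L.curve A}

variable {L} {A B : Set (Fin Γ.n)} {v w z : Fin Γ.n} {u a : ℤ × ℤ} {x : Plane}

theorem mem_star_of_mem_arms (hu : u ∈ (L.tripod v).arms) : u ∈ Γ.star v :=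
  L.star_eq v ▸ (L.tripod v).arms_subset_star hu

theorem mem_curve_iff :
    x ∈ L.curve A ↔ ∃ v ∈ A, ∃ u ∈ (L.tripod v).arms, x ∈ Γ.closedEdge v u := by
  simp only [curve, Set.mem_iUnion, exists_prop]

theorem curve_subset_below : L.curve A ⊆ L.below A :=
  fun _ hx => ⟨0, Set.self_mem_Ici, by rwa [zero_smul, add_zero]⟩

theorem curve_mono (h : A ⊆ B) : L.curve A ⊆ L.curve B :=
  Set.biUnion_subset_biUnion_left h

theorem pos_mem_curve (R : Γ.IsReversible) (hv : v ∈ A) : Γ.pos v ∈ L.curve A :=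
  mem_curve_iff.2 ⟨v, hv, _, (L.tripod v).I_mem_arms,
    R.pos_mem_closedEdge (mem_star_of_mem_arms (L.tripod v).I_mem_arms)⟩

theorem isClosed_below (R : Γ.IsReversible) : IsClosed (L.below A) := by
  have hunion : L.below A = ⋃ v ∈ A, ⋃ u ∈ (L.tripod v).arms,
      {x | ∃ τ ∈ Set.Ici (0 : ℝ), x + τ • c ∈ Γ.closedEdge v u} := by
    ext x
    simp only [below, mem_curve_iff, Set.mem_iUnion, Set.mem_ofPred_eq, exists_prop]
    tauto
  rw [hunion]
  refine A.toFinite.isClosed_biUnion fun v _ => isClosed_biUnion_finset fun u hu => ?_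
  rw [closedEdge, setOf_exists_add_smul_mem_image_line
    ((L.tripod v).planeDet_ne_zero_of_mem_arms hu)]
  exact ((R.isClosed_reach (mem_star_of_mem_arms hu)).prod isClosed_Ici).preimage (by fun_prop)

theorem below_mem_nhds_of_mem_openEdge (hv : v ∈ A) (hu : u ∈ (L.tripod v).arms) {τ : ℝ}
    (hτ : 0 < τ) (hx : x + τ • c ∈ Γ.openEdge v u) : L.below A ∈ 𝓝 x := by
  have hopen : IsOpen {x | ∃ τ ∈ Set.Ioi (0 : ℝ), x + τ • c ∈ Γ.openEdge v u} := by
    rw [openEdge, setOf_exists_add_smul_mem_image_line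
      ((L.tripod v).planeDet_ne_zero_of_mem_arms hu)]
    exact (isOpen_interior.prod isOpen_Ioi).preimage (by fun_prop)
  filter_upwards [hopen.mem_nhds ⟨τ, hτ, hx⟩]
  rintro y ⟨σ, hσ, hy⟩
  exact ⟨σ, hσ.out.le, mem_curve_iff.2 ⟨v, hv, u, hu, openEdge_subset_closedEdge hy⟩⟩

theorem eventually_mem_below_of_arm (R : Γ.IsReversible) (hv : v ∈ A)
    (hu : u ∈ (L.tripod v).arms) {τ : ℝ} (hτ : 0 < τ) (hx : x + τ • c = Γ.pos v) :
    ∀ᶠ y in 𝓝 x, 0 ≤ planeDet c (y - Γ.pos v) / planeDet c (latticeVec u) → y ∈ L.below A := by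
  have hcu := (L.tripod v).planeDet_ne_zero_of_mem_arms hu
  obtain ⟨hfx, hgx⟩ := (add_smul_eq_add_smul_iff (t := 0) hcu).1
    (hx.trans (by rw [zero_smul, add_zero]))
  have hf : Tendsto (fun y => planeDet c (y - Γ.pos v) / planeDet c (latticeVec u)) (𝓝 x) (𝓝 0) :=
    hfx ▸ Continuous.tendsto (by fun_prop) x
  have hg : Tendsto (fun y => planeDet (latticeVec u) (y - Γ.pos v) / planeDet c (latticeVec u))
      (𝓝 x) (𝓝 τ) := hgx ▸ Continuous.tendsto (by fun_prop) x
  have hreach := R.reach_mem_nhdsGE (mem_star_of_mem_arms hu)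
  rw [mem_nhdsWithin_iff_eventually] at hreach
  filter_upwards [hf.eventually hreach, hg.eventually_const_lt hτ] with y hy hσ h0
  exact ⟨_, hσ.le, mem_curve_iff.2 ⟨v, hv, u, hu, _, hy h0,
    ((add_smul_eq_add_smul_iff hcu).2 ⟨rfl, rfl⟩).symm⟩⟩

theorem below_mem_nhds_of_eq_pos (R : Γ.IsReversible) (hv : v ∈ A) {τ : ℝ} (hτ : 0 < τ)
    (hx : x + τ • c = Γ.pos v) : L.below A ∈ 𝓝 x := by
  have hneg := (L.tripod v).planeDet_I_mul_planeDet_J_neg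
  filter_upwards [eventually_mem_below_of_arm R hv (L.tripod v).I_mem_arms hτ hx,
    eventually_mem_below_of_arm R hv (L.tripod v).J_mem_arms hτ hx] with y hI hJ
  by_contra hy
  have hlt := mul_pos_of_neg_of_neg (lt_of_not_ge fun h0 => hy (hI h0))
    (lt_of_not_ge fun h0 => hy (hJ h0))
  rw [div_mul_div_comm] at hlt
  exact hlt.not_ge (div_nonpos_of_nonneg_of_nonpos (mul_self_nonneg _) hneg.le)

namespace IsStrand

variable (hA : L.IsStrand A)
include hA

theorem below_mem_nhds (R : Γ.IsReversible) (hx : x ∈ L.below A) (hxA : x ∉ L.curve A) :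
    L.below A ∈ 𝓝 x := by
  obtain ⟨τ, hτ, hxτ⟩ := hx
  have hpos : 0 < τ := hτ.out.lt_of_ne fun h0 => hxA (by rwa [← h0, zero_smul, add_zero] at hxτ)
  obtain ⟨v, hv, u, hu, hxu⟩ := mem_curve_iff.1 hxτ
  rcases R.mem_closedEdge_cases (mem_star_of_mem_arms hu) hxu with hopen | hend | ⟨w, hw, hend⟩
  · exact below_mem_nhds_of_mem_openEdge hv hu hpos hopen
  · exact below_mem_nhds_of_eq_pos R hv hpos hend
  · exact below_mem_nhds_of_eq_pos R (hA v hv u hu w hw).1 hpos hend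

theorem subset_below (R : Γ.IsReversible) {s : Set Plane} (hs : IsPreconnected s)
    (hsA : Disjoint s (L.curve A)) (hsB : (s ∩ L.below A).Nonempty) : s ⊆ L.below A := by
  have hinterior : s ∩ L.below A ⊆ interior (L.below A) := fun y hy =>
    mem_interior_iff_mem_nhds.2 (hA.below_mem_nhds R hy.2 (Set.disjoint_left.1 hsA hy.1))
  refine (hs.subset_of_closure_inter_subset isOpen_interior ?_ ?_).trans interior_subset
  · exact hsB.mono fun y hy => ⟨hy.1, hinterior hy⟩
  · rintro y ⟨hy, hys⟩
    exact hinterior ⟨hys, closure_minimal interior_subset (isClosed_below R) hy⟩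

theorem sameEdge_mem (hz : Γ.SameEdge z a v u) (hv : v ∈ A) (hu : u ∈ (L.tripod v).arms) :
    z ∈ A ∧ a ∈ (L.tripod z).arms := by
  rcases hz with ⟨rfl, rfl⟩ | ⟨hw, rfl⟩
  · exact ⟨hv, hu⟩
  · exact hA v hv u hu z hw

theorem mem_of_pos_mem_curve (h : Γ.IsTropicalCurve) (hv : Γ.pos v ∈ L.curve A) : v ∈ A := by
  obtain ⟨z, hz, u, hu, hvz⟩ := mem_curve_iff.1 hv
  obtain ⟨a, ha⟩ := h.exists_sameEdge_of_pos_mem_closedEdge (mem_star_of_mem_arms hu) hvz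
  exact (hA.sameEdge_mem ha hz hu).1

theorem disjoint_openEdge_curve (h : Γ.IsTropicalCurve) (hu : u ∈ Γ.star v)
    (hvu : ¬(v ∈ A ∧ u ∈ (L.tripod v).arms)) : Disjoint (Γ.openEdge v u) (L.curve A) := by
  have R := h.isReversible
  refine Set.disjoint_left.2 fun x hx hxA => ?_
  obtain ⟨v', hv', u', hu', hx'⟩ := mem_curve_iff.1 hxA
  obtain ⟨z, a, a', hz, hz'⟩ := h.exists_common_end hu (mem_star_of_mem_arms hu')
    (openEdge_subset_closedEdge hx) hx'
  obtain ⟨hzA, ha'⟩ := hA.sameEdge_mem hz' hv' hu'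
  by_cases haa : a = a'
  · exact hvu (hA.sameEdge_mem (hz.symm R) hzA (haa ▸ ha'))
  · have hxz : x = Γ.pos z :=
      R.eq_pos_of_mem_closedEdge (hz.mem_star R hu) (mem_star_of_mem_arms ha') haa
        (hz.closedEdge_eq R ▸ openEdge_subset_closedEdge hx) (hz'.closedEdge_eq R ▸ hx')
    exact h.pos_notMem_openEdge hu z (hxz ▸ hx)

end IsStrand

theorem exists_mem_openEdge_K_mem_below (R : Γ.IsReversible) (hv : v ∈ A) :
    (Γ.openEdge v (L.tripod v).K ∩ L.below A).Nonempty := by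
  let T := L.tripod v
  have hscale : ∀ {a : ℝ}, 0 < a → Tendsto (fun r : ℝ => r * a) (𝓝[>] 0) (𝓝[>] 0) := fun ha =>
    tendsto_nhdsWithin_iff.2 ⟨((continuous_mul_const _).tendsto' 0 0 (zero_mul _)).mono_left
      nhdsWithin_le_nhds, eventually_mem_nhdsWithin.mono fun r hr => mul_pos hr ha⟩
  have hK := R.interior_reach_mem_nhdsGT (L.star_eq v ▸ T.K_mem_star)
  have hJ := nhdsWithin_mono 0 Set.Ioi_subset_Ici_self
    (R.reach_mem_nhdsGE (L.star_eq v ▸ T.J_mem_star))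
  obtain ⟨r, hr, hrK, hrJ⟩ := (eventually_mem_nhdsWithin.and
    (((hscale T.coordI_pos).eventually hK).and ((hscale T.gap_pos).eventually hJ))).exists
  refine ⟨_, ⟨_, hrK, rfl⟩, r, hr.out.le, mem_curve_iff.2 ⟨v, hv, T.J, T.J_mem_arms, _, hrJ, ?_⟩⟩
  change _ + (r * T.gap c) • latticeVec T.J = _ + (r * T.coordI c) • latticeVec T.K + r • c
  rw [mul_smul, T.gap_smul_J c]
  module

namespace IsStrand

variable (hA : L.IsStrand A) (h : Γ.IsTropicalCurve)
include hA h

theorem closedEdge_subset_below (hu : u ∈ Γ.star v) (hvu : ¬(v ∈ A ∧ u ∈ (L.tripod v).arms))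
    (hv : Γ.pos v ∈ L.below A) : Γ.closedEdge v u ⊆ L.below A := by
  have R := h.isReversible
  suffices hmeet : (Γ.openEdge v u ∩ L.below A).Nonempty by
    rw [← R.closure_openEdge hu]
    exact closure_minimal (hA.subset_below R convex_openEdge.isPreconnected
      (hA.disjoint_openEdge_curve h hu hvu) hmeet) (isClosed_below R)
  by_cases hvA : v ∈ A
  · obtain rfl := ((L.tripod v).mem_arms_or_eq_K (L.star_eq v ▸ hu)).resolve_left
      fun hu' => hvu ⟨hvA, hu'⟩
    exact exists_mem_openEdge_K_mem_below R hvA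
  · have hclosure : Γ.pos v ∈ closure (Γ.openEdge v u) :=
      R.closure_openEdge hu ▸ R.pos_mem_closedEdge hu
    rw [Set.inter_comm]
    exact mem_closure_iff_nhds.1 hclosure _
      (hA.below_mem_nhds R hv fun hcurve => hvA (hA.mem_of_pos_mem_curve h hcurve))

theorem below_of_adj (hvw : Γ.graph.Adj v w) (hv : Γ.pos v ∈ L.below A) :
    Γ.pos w ∈ L.below A := by
  have R := h.isReversible
  obtain ⟨u, hw⟩ := h.adj_heads v w hvw
  by_cases hvu : v ∈ A ∧ u ∈ (L.tripod v).arms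
  · exact curve_subset_below (pos_mem_curve R (hA v hvu.1 u hvu.2 w hw).1)
  · refine hA.closedEdge_subset_below h hw.1 hvu hv ?_
    rw [R.closedEdge_eq_segment hw]
    exact right_mem_segment ℝ _ _

theorem below_of_reachable (hvw : Γ.graph.Reachable v w) (hv : Γ.pos v ∈ L.below A) :
    Γ.pos w ∈ L.below A := by
  obtain ⟨p⟩ := hvw
  induction p with
  | nil => exact hv
  | cons hadj _ ih => exact ih (hA.below_of_adj h hadj hv)

theorem mem_of_mem_closedEdge (hB : L.IsStrand B) (hv : v ∈ B) (hu : u ∈ (L.tripod v).arms)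
    (hx : x ∈ Γ.closedEdge v u) (hxA : x ∈ L.curve A) : v ∈ A := by
  obtain ⟨v', hv', u', hu', hx'⟩ := mem_curve_iff.1 hxA
  obtain ⟨z, a, a', hz, hz'⟩ :=
    h.exists_common_end (mem_star_of_mem_arms hu) (mem_star_of_mem_arms hu') hx hx'
  exact (hA.sameEdge_mem (hz.symm h.isReversible) (hA.sameEdge_mem hz' hv' hu').1
    (hB.sameEdge_mem hz hv hu).2).1

end IsStrand

theorem finite_setOf_add_smul_mem_curve (x : Plane) (A : Set (Fin Γ.n)) :
    {τ : ℝ | x + τ • c ∈ L.curve A}.Finite := by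
  have hunion : {τ : ℝ | x + τ • c ∈ L.curve A} =
      ⋃ v ∈ A, ⋃ u ∈ (L.tripod v).arms, {τ | x + τ • c ∈ Γ.closedEdge v u} := by
    ext τ
    simp only [mem_curve_iff, Set.mem_iUnion, Set.mem_ofPred_eq, exists_prop]
  rw [hunion]
  refine A.toFinite.biUnion fun v _ => (L.tripod v).arms.finite_toSet.biUnion fun u hu =>
    Set.Subsingleton.finite ?_
  have hcu := (L.tripod v).planeDet_ne_zero_of_mem_arms hu
  rintro τ ⟨t, -, hτ⟩ τ' ⟨t', -, hτ'⟩
  exact ((add_smul_eq_add_smul_iff hcu).1 hτ.symm).2.trans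
    ((add_smul_eq_add_smul_iff hcu).1 hτ'.symm).2.symm

theorem IsStrand.exists_mem_substrand (hB : L.IsStrand B) (h : Γ.IsTropicalCurve)
    (hne : B.Nonempty) :
    ∃ v ∈ B, ∀ A ⊆ B, L.IsStrand A → (∃ w ∈ A, Γ.graph.Reachable w v) → v ∈ A := by
  have R := h.isReversible
  obtain ⟨v₀, hv₀⟩ := hne
  obtain ⟨τ, hτ, hmax⟩ := Set.exists_max_image _ id
    (finite_setOf_add_smul_mem_curve (L := L) (Γ.pos v₀) B)
    ⟨0, by simpa using pos_mem_curve R hv₀⟩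
  -- Take `v` on the arm through the last point of the curve of `B` on the ray from `v₀` in
  -- direction `c`. A substrand missing `v` would pass strictly above that point.
  obtain ⟨v, hv, u, hu, hx⟩ := mem_curve_iff.1 hτ.out
  refine ⟨v, hv, fun A hAB hA ⟨w, hw, hwv⟩ => ?_⟩
  by_contra hvA
  have hvbelow := hA.below_of_reachable h hwv (curve_subset_below (pos_mem_curve R hw))
  obtain ⟨σ, hσ, hxσ⟩ := hA.closedEdge_subset_below h (mem_star_of_mem_arms hu)
    (fun hvu => hvA hvu.1) hvbelow hx
  rw [add_assoc, ← add_smul] at hxσ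
  have hle : τ + σ ≤ τ := hmax (τ + σ) (curve_mono hAB hxσ)
  obtain rfl : σ = 0 := le_antisymm (by linarith) hσ.out
  rw [add_zero] at hxσ
  exact hvA (hA.mem_of_mem_closedEdge h hB hv hu hx hxσ)

/-! ### The crossing points as a function of the displacement -/

variable (L)

/-- The displacement from each vertex of `Γ` to the point of its `J`-edge at which the displaced
curve crosses that edge, as a function of the displacement of the vertices. -/
def shift : (Fin Γ.n → Plane) →ₗ[ℝ] (Fin Γ.n → Plane) where
  toFun δ v := (L.tripod v).gap (δ v) • latticeVec (L.tripod v).J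
  map_add' δ δ' := funext fun v => by simp only [Pi.add_apply, map_add, add_smul]
  map_smul' r δ := funext fun v => by
    simp only [Pi.smul_apply, map_smul, smul_eq_mul, mul_smul, RingHom.id_apply]

theorem shift_apply (δ : Fin Γ.n → Plane) (v : Fin Γ.n) :
    L.shift δ v = (L.tripod v).gap (δ v) • latticeVec (L.tripod v).J := rfl

variable {L} {δ : Fin Γ.n → Plane}

theorem gap_eq_zero_of_shift_eq_zero (h0 : L.shift δ = 0) (v : Fin Γ.n) :
    (L.tripod v).gap (δ v) = 0 :=
  (smul_eq_zero.1 (congrFun h0 v)).resolve_right (L.tripod v).latticeVec_J_ne_zero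

theorem isStrand_of_shift_eq_zero (h : Γ.IsTropicalCurve) (hδ : δ ∈ Γ.slopeSpace)
    (h0 : L.shift δ = 0) (C : Γ.graph.ConnectedComponent) :
    L.IsStrand {v | v ∈ C.supp ∧ δ v ≠ 0} := by
  have hgap := gap_eq_zero_of_shift_eq_zero h0
  rintro v ⟨hvC, hv⟩ u hu w hw
  have hdet : planeDet (latticeVec u) (δ w) ≠ 0 :=
    planeDet_eq_of_headsTo hδ hw ▸ (L.tripod v).planeDet_ne_zero_of_gap_eq_zero (hgap v) hv hu
  refine ⟨⟨C.mem_supp_of_adj_mem_supp hvC hw.2.1, fun hw0 => hdet (by rw [hw0, map_zero])⟩, ?_⟩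
  refine ((L.tripod w).mem_arms_or_eq_K (L.star_eq w ▸ (h.heads_symm hw).1)).resolve_right
    fun hK => hdet ?_
  have hdetK := (L.tripod w).gap_eq_zero_iff.1 (hgap w)
  rwa [← hK, latticeVec_neg, map_neg, LinearMap.neg_apply, neg_eq_zero] at hdetK

theorem exists_determining_vertex (h : Γ.IsTropicalCurve) (L : Γ.TripodLabelling c)
    (C : Γ.graph.ConnectedComponent) :
    ∃ v, ∀ δ ∈ Γ.slopeSpace, L.shift δ = 0 → δ v = 0 → ∀ w ∈ C.supp, δ w = 0 := by
  let B : Set (Fin Γ.n) := {v | ∃ δ ∈ Γ.slopeSpace, L.shift δ = 0 ∧ v ∈ C.supp ∧ δ v ≠ 0}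
  have hB : L.IsStrand B := by
    rintro v ⟨δ, hδ, h0, hv⟩ u hu w hw
    obtain ⟨hw', hu'⟩ := isStrand_of_shift_eq_zero h hδ h0 C v hv u hu w hw
    exact ⟨⟨δ, hδ, h0, hw'⟩, hu'⟩
  rcases B.eq_empty_or_nonempty with hempty | hne
  · refine ⟨⟨0, h.nonempty⟩, fun δ hδ h0 _ w hw => not_not.1 fun hδw => ?_⟩
    exact (hempty ▸ ⟨δ, hδ, h0, hw, hδw⟩ : w ∈ (∅ : Set _))
  · obtain ⟨v, ⟨_, _, _, hvC, _⟩, hmin⟩ := hB.exists_mem_substrand h hne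
    refine ⟨v, fun δ hδ h0 hδv w hw => not_not.1 fun hδw => ?_⟩
    exact (hmin _ (fun z hz => ⟨δ, hδ, h0, hz⟩) (isStrand_of_shift_eq_zero h hδ h0 C)
      ⟨w, ⟨hw, hδw⟩, SimpleGraph.ConnectedComponent.exact (hw.trans hvC.symm)⟩).2 hδv

theorem finrank_ker_shift_le (h : Γ.IsTropicalCurve) (L : Γ.TripodLabelling c) :
    Module.finrank ℝ (LinearMap.ker (L.shift.domRestrict Γ.slopeSpace)) ≤
      Nat.card Γ.graph.ConnectedComponent := by
  classical
  choose b hb using exists_determining_vertex h L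
  let f : LinearMap.ker (L.shift.domRestrict Γ.slopeSpace) →ₗ[ℝ]
      (Γ.graph.ConnectedComponent → ℝ) :=
    { toFun δ C := (L.tripod (b C)).coordI (δ.1.1 (b C))
      map_add' δ δ' := funext fun C => map_add (L.tripod (b C)).coordI _ _
      map_smul' r δ := funext fun C => map_smul (L.tripod (b C)).coordI r _ }
  have hinj : Function.Injective f := by
    rw [injective_iff_map_eq_zero]
    rintro ⟨⟨δ, hδ⟩, h0⟩ hf
    have hzero : ∀ C, δ (b C) = 0 := fun C => by
      have hcoordI : (L.tripod (b C)).coordI (δ (b C)) = 0 := congrFun hf C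
      have hdecomp := (L.tripod (b C)).gap_smul_J (δ (b C))
      rwa [gap_eq_zero_of_shift_eq_zero (δ := δ) h0, hcoordI, zero_smul, zero_smul, add_zero,
        eq_comm] at hdecomp
    exact Subtype.ext (Subtype.ext (funext fun w => hb _ δ hδ h0 (hzero _) w rfl))
  have hle := LinearMap.finrank_le_finrank_of_injective hinj
  rwa [Module.finrank_fintype_fun_eq_card, ← Nat.card_eq_fintype_card] at hle

theorem two_mul_le_finrank_range_shift_add (h : Γ.IsTropicalCurve) (L : Γ.TripodLabelling c) :
    2 * Γ.n ≤ Module.finrank ℝ (LinearMap.range (L.shift.domRestrict Γ.slopeSpace)) +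
      Nat.card Γ.graph.ConnectedComponent + Nat.card Γ.graph.edgeSet := by
  have hker := finrank_ker_shift_le h L
  have hrank := LinearMap.finrank_range_add_finrank_ker (L.shift.domRestrict Γ.slopeSpace)
  have hdim := two_mul_le_finrank_slopeSpace_add_card_edgeSet (Γ := Γ)
  lia

end PlaneGraph.TripodLabelling

/-! ### Intersection with a displaced curve -/

theorem divisorOf_apply {k : ℕ} (x : Fin k → Plane) (p : Plane) :
    divisorOf x p = ∑ i, if x i = p then 1 else 0 := by
  simp only [divisorOf, Finsupp.finsetSum_apply, Finsupp.single_apply]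

theorem divisorOf_eq_zero {k : ℕ} {x : Fin k → Plane} {p : Plane} (h : ∀ i, x i ≠ p) :
    divisorOf x p = 0 := by
  simp only [divisorOf_apply, h, if_false, Finset.sum_const_zero]

theorem divisorOf_apply_self {k : ℕ} {x : Fin k → Plane} (h : Function.Injective x) (i : Fin k) :
    divisorOf x (x i) = 1 := by
  simp only [divisorOf_apply, h.eq_iff, Finset.sum_ite_eq', Finset.mem_univ, if_true]

namespace PlaneGraph

variable {Γ : PlaneGraph}

theorem translate_zero : Γ.translate 0 = Γ := by
  simp only [translate, add_zero]

theorem IsProperIntersection.isStableIntersection {Γ' : PlaneGraph} {k : ℕ} {x : Fin k → Plane}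
    (h : Γ.IsProperIntersection Γ' (divisorOf x)) : Γ.IsStableIntersection Γ' (divisorOf x) := by
  refine ⟨0, k, fun _ => x, x, Eventually.of_forall fun ε => ?_, tendsto_const_nhds, rfl⟩
  rwa [smul_zero, translate_zero]

theorem IsReversible.mem_interior_reach_of_norm_lt (R : Γ.IsReversible) {v : Fin Γ.n} {u : ℤ × ℤ}
    (hu : u ∈ Γ.star v) {t : ℝ} (ht : 0 < t)
    (hlt : ∀ w, v ≠ w → ‖t • latticeVec u‖ < ‖Γ.pos w - Γ.pos v‖) :
    t ∈ interior (Γ.reach v u) := by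
  rcases exists_headsTo_or_isRay hu with ⟨w, hw⟩ | hray
  · obtain ⟨s, hs, hpos⟩ := hw.2.2
    have hts := hlt w hw.2.1.ne
    rw [hpos, add_sub_cancel_left, norm_smul, norm_smul, Real.norm_of_nonneg ht.le,
      Real.norm_of_nonneg hs.le] at hts
    rw [R.reach_eq hw hpos, interior_Icc]
    exact ⟨ht, lt_of_mul_lt_mul_right hts (norm_nonneg _)⟩
  · rwa [hray.reach_eq, interior_Ici]

namespace TripodLabelling

variable {c : Plane} {L : Γ.TripodLabelling c} {η : ℝ} {δ : Fin Γ.n → Plane}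

/-- A small deformation that displaces each vertex into the cone of its tripod. -/
structure IsAdmissible (L : Γ.TripodLabelling c) (η : ℝ) (δ : Fin Γ.n → Plane) : Prop
    extends Γ.IsSmallDeformation η δ where
  norm_shift_lt : ‖L.shift δ‖ < η
  mem_cone : ∀ v, 0 < (L.tripod v).coordI (δ v) ∧ 0 < (L.tripod v).gap (δ v)

theorem isOpen_setOf_isAdmissible (L : Γ.TripodLabelling c) (hη : Γ.IsSmallScale η) :
    IsOpen {δ : Γ.slopeSpace | L.IsAdmissible η δ} := by
  have hset : {δ : Γ.slopeSpace | L.IsAdmissible η δ} =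
      ({δ : Γ.slopeSpace | ‖(δ : Fin Γ.n → Plane)‖ < η} ∩ {δ : Γ.slopeSpace | ‖L.shift δ‖ < η}) ∩
        ⋂ v, ({δ : Γ.slopeSpace | 0 < (L.tripod v).coordI (δ.1 v)} ∩
          {δ : Γ.slopeSpace | 0 < (L.tripod v).gap (δ.1 v)}) := by
    ext δ
    simp only [Set.mem_inter_iff, Set.mem_iInter, Set.mem_ofPred_eq]
    exact ⟨fun h => ⟨⟨h.norm_lt, h.norm_shift_lt⟩, h.mem_cone⟩,
      fun h => ⟨⟨hη, δ.2, h.1.1⟩, h.1.2, h.2⟩⟩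
  have hshift := L.shift.continuous_of_finiteDimensional
  have hvertex (v : Fin Γ.n) (f : Plane →ₗ[ℝ] ℝ) : Continuous fun δ : Γ.slopeSpace => f (δ.1 v) :=
    f.continuous_of_finiteDimensional.comp ((continuous_apply v).comp continuous_subtype_val)
  rw [hset]
  refine ((isOpen_lt (by fun_prop) (by fun_prop)).inter
    (isOpen_lt (by fun_prop) (by fun_prop))).inter (isOpen_iInter_of_finite fun v => ?_)
  exact (isOpen_lt continuous_const (hvertex v _)).inter (isOpen_lt continuous_const (hvertex v _))

theorem exists_isAdmissible_const (L : Γ.TripodLabelling c) (hη : Γ.IsSmallScale η) :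
    ∃ s : ℝ, L.IsAdmissible η fun _ => s • c := by
  have hsmall : ∀ x : Fin Γ.n → Plane, ∀ᶠ s in 𝓝[>] (0 : ℝ), ‖s • x‖ < η := fun x =>
    (((continuous_id.smul continuous_const).norm.tendsto' 0 0 (by simp)).mono_left
      nhdsWithin_le_nhds).eventually_lt_const hη.pos
  obtain ⟨s, hs, hδ, hshift⟩ := (eventually_mem_nhdsWithin.and
    ((hsmall fun _ => c).and (hsmall (L.shift fun _ => c)))).exists
  rw [← map_smul] at hshift
  refine ⟨s, ⟨hη, const_mem_slopeSpace _, hδ⟩, hshift, fun v => ?_⟩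
  rw [map_smul, map_smul]
  exact ⟨smul_pos hs.out (L.tripod v).coordI_pos, smul_pos hs.out (L.tripod v).gap_pos⟩

namespace IsAdmissible

variable (D : L.IsAdmissible η δ)
include D

theorem norm_shift_apply_lt (v : Fin Γ.n) : ‖L.shift δ v‖ < η :=
  (norm_le_pi_norm _ v).trans_lt D.norm_shift_lt

theorem injective_pos_add_shift : Function.Injective fun v => Γ.pos v + L.shift δ v := by
  intro v w hvw
  by_contra hne
  have hdist := D.isSmallScale.four_mul_le_dist v w hne
  rw [sub_eq_sub_iff_add_eq_add.2 ((hvw.symm).trans (add_comm _ _))] at hdist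
  linarith [D.isSmallScale.pos, norm_sub_le (L.shift δ v) (L.shift δ w),
    D.norm_shift_apply_lt v, D.norm_shift_apply_lt w]

theorem pos_add_shift_mem_openEdge (h : Γ.IsTropicalCurve) (v : Fin Γ.n) :
    Γ.pos v + L.shift δ v ∈ Γ.openEdge v (L.tripod v).J := by
  refine ⟨_, h.isReversible.mem_interior_reach_of_norm_lt (L.star_eq v ▸ (L.tripod v).J_mem_star)
    (D.mem_cone v).2 fun w hw => ?_, rfl⟩
  rw [← shift_apply]
  linarith [D.isSmallScale.pos, D.isSmallScale.four_mul_le_dist v w hw, D.norm_shift_apply_lt v]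

theorem pos_add_shift_mem_openEdge_deform (h : Γ.IsTropicalCurve) (v : Fin Γ.n) :
    Γ.pos v + L.shift δ v ∈ (Γ.deform δ).openEdge v (L.tripod v).K := by
  have hJK : L.shift δ v = δ v + (L.tripod v).coordI (δ v) • latticeVec (L.tripod v).K :=
    (L.tripod v).gap_smul_J (δ v)
  refine ⟨_, (D.isReversible h).mem_interior_reach_of_norm_lt
    (L.star_eq v ▸ (L.tripod v).K_mem_star) (D.mem_cone v).1 fun w hw => ?_, ?_⟩
  · have hpos : (Γ.deform δ).pos w - (Γ.deform δ).pos v =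
        (Γ.pos w - Γ.pos v) - (δ v - δ w) := by
      change Γ.pos w + δ w - (Γ.pos v + δ v) = _
      abel
    rw [hpos, ← sub_eq_iff_eq_add'.2 hJK]
    linarith [D.isSmallScale.four_mul_le_dist v w hw, norm_sub_le (L.shift δ v) (δ v),
      norm_sub_norm_le (Γ.pos w - Γ.pos v) (δ v - δ w), norm_sub_le (δ v) (δ w),
      D.norm_shift_apply_lt v, D.norm_apply_lt v, D.norm_apply_lt w]
  · rw [hJK, ← add_assoc]
    rfl

theorem exists_eq_pos_add_shift (h : Γ.IsTropicalCurve) {p : Plane} (hp : p ∈ Γ.support)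
    (hp' : p ∈ (Γ.deform δ).support) : ∃ v, p = Γ.pos v + L.shift δ v := by
  have R := h.isReversible
  have R' := D.isReversible h
  obtain ⟨v, u, hu, hp⟩ := (R.mem_support_iff h.star_nonempty).1 hp
  obtain ⟨v', u', hu', hp'⟩ := (R'.mem_support_iff h.star_nonempty).1 hp'
  obtain ⟨z, a, a', hz, hz'⟩ := h.exists_common_end_of_mem_thickening D.isSmallScale hu hu'
    (Metric.self_subset_thickening D.isSmallScale.pos _ hp)
    (D.closedEdge_subset_thickening h hu' hp')
  rw [← hz.closedEdge_eq R] at hp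
  rw [← (D.sameEdge h hz').closedEdge_eq R'] at hp'
  obtain ⟨t, ht, rfl⟩ := hp
  obtain ⟨t', ht', hmeet⟩ := hp'
  change Γ.pos z + δ z + t' • latticeVec a' = Γ.pos z + t • latticeVec a at hmeet
  rw [add_assoc, add_right_inj] at hmeet
  obtain ⟨rfl, rfl⟩ := (L.tripod z).eq_J_and_eq_gap_of_meet (D.mem_cone z).1 (D.mem_cone z).2
    (L.star_eq z ▸ hz.mem_star R hu) (L.star_eq z ▸ hz'.mem_star R hu') ht.1 ht'.1 hmeet.symm
  exact ⟨z, rfl⟩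

theorem isProperIntersection_deform (h : Γ.IsTropicalCurve) :
    Γ.IsProperIntersection (Γ.deform δ) (divisorOf fun v => Γ.pos v + L.shift δ v) := by
  have hopen : ∀ v, Γ.IsOpenEdge (Γ.openEdge v (L.tripod v).J) (L.tripod v).J := fun v =>
    h.isReversible.isOpenEdge_iff.2 ⟨v, L.star_eq v ▸ (L.tripod v).J_mem_star, rfl⟩
  have hopen' : ∀ v : Fin Γ.n,
      (Γ.deform δ).IsOpenEdge ((Γ.deform δ).openEdge v (L.tripod v).K) (L.tripod v).K := fun v =>
    (D.isReversible h).isOpenEdge_iff.2 ⟨v, L.star_eq v ▸ (L.tripod v).K_mem_star, rfl⟩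
  have hmem := D.pos_add_shift_mem_openEdge h
  have hmem' := D.pos_add_shift_mem_openEdge_deform h
  refine ⟨fun p hp => divisorOf_eq_zero ?_, ?_⟩
  · rintro v rfl
    exact hp ⟨Or.inr ⟨_, _, hopen v, hmem v⟩, Or.inr ⟨_, _, hopen' v, hmem' v⟩⟩
  · rintro p ⟨hp, hp'⟩
    obtain ⟨v, rfl⟩ := D.exists_eq_pos_add_shift h hp hp'
    have hdet := (L.tripod v).abs_latticeDet_J_K
    exact ⟨_, _, _, _, hopen v, hmem v, hopen' v, hmem' v, abs_ne_zero.1 (hdet ▸ one_ne_zero),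
      (divisorOf_apply_self D.injective_pos_add_shift v).trans hdet.symm⟩

end IsAdmissible

end PlaneGraph.TripodLabelling

/-! ### Counting dimensions -/

theorem exists_submodule_le_finrank_eq {K V : Type*} [DivisionRing K] [AddCommGroup V] [Module K V]
    (N : Submodule K V) {m : ℕ} (hm : m ≤ Module.finrank K N) :
    ∃ M ≤ N, Module.finrank K M = m := by
  obtain ⟨f, hf⟩ := exists_linearIndependent_of_le_finrank hm
  refine ⟨(Submodule.span K (Set.range f)).map N.subtype, Submodule.map_subtype_le _ _, ?_⟩
  rw [Submodule.finrank_map_subtype_eq, finrank_span_eq_card hf, Fintype.card_fin]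

theorem exists_affineSubspace_inter_subset_image {V W : Type*} [NormedAddCommGroup V]
    [NormedSpace ℝ V] [FiniteDimensional ℝ V] [NormedAddCommGroup W] [NormedSpace ℝ W]
    (F : V →ₗ[ℝ] W) (p : W) {O : Set V} (hO : IsOpen O) (hne : O.Nonempty) {m : ℕ}
    (hm : m ≤ Module.finrank ℝ (LinearMap.range F)) :
    ∃ (L : AffineSubspace ℝ W) (U : Set W), IsOpen U ∧ (U ∩ (L : Set W)).Nonempty ∧
      Module.finrank ℝ L.direction = m ∧ U ∩ (L : Set W) ⊆ (fun x => p + F x) '' O := by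
  obtain ⟨x₀, hx₀⟩ := hne
  obtain ⟨M, hM, hMm⟩ := exists_submodule_le_finrank_eq (LinearMap.range F) hm
  obtain ⟨U, hU, hUO⟩ := isOpen_induced_iff.1
    (F.rangeRestrict.isOpenMap_of_finiteDimensional F.surjective_rangeRestrict _ hO)
  refine ⟨AffineSubspace.mk' (p + F x₀) M, (fun y => y - p) ⁻¹' U, hU.preimage (by fun_prop),
    ⟨p + F x₀, ?_, AffineSubspace.self_mem_mk' _ _⟩, by rw [AffineSubspace.direction_mk', hMm], ?_⟩
  · have hF : F.rangeRestrict x₀ ∈ Subtype.val ⁻¹' U := hUO ▸ Set.mem_image_of_mem _ hx₀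
    rwa [Set.mem_preimage, add_sub_cancel_left]
  · rintro y ⟨hyU, hyL⟩
    rw [SetLike.mem_coe, AffineSubspace.mem_mk', vsub_eq_sub, ← sub_sub] at hyL
    have hrange : y - p ∈ LinearMap.range F :=
      (Submodule.sub_mem_iff_left _ (LinearMap.mem_range_self F x₀)).1 (hM hyL)
    have hyO : (⟨y - p, hrange⟩ : LinearMap.range F) ∈ F.rangeRestrict '' O :=
      hUO ▸ (hyU : y - p ∈ U)
    obtain ⟨x, hx, hxy⟩ := hyO
    exact ⟨x, hx, add_eq_of_eq_sub' (congrArg Subtype.val hxy)⟩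

section Degree

variable {V : Type*} [Fintype V] {G : SimpleGraph V} [DecidableRel G.Adj] {k : ℕ}

theorem two_le_sum_succ_sub_degree [DecidableEq G.ConnectedComponent] (hk : 1 ≤ k)
    (hdeg : ∀ v, G.degree v ≤ k) (C : G.ConnectedComponent) :
    2 ≤ ∑ v with G.connectedComponentMk v = C, (k + 1 - G.degree v) := by
  induction C using SimpleGraph.ConnectedComponent.ind with | h v
  set S : Finset V := {w | G.connectedComponentMk w = G.connectedComponentMk v}
  have mem_component {w : V} (hw : G.connectedComponentMk w = G.connectedComponentMk v) : w ∈ S :=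
    Finset.mem_filter.2 ⟨Finset.mem_univ w, hw⟩
  have hnonneg : ∀ w ∈ S, 0 ≤ k + 1 - G.degree w := fun _ _ => Nat.zero_le _
  rcases Nat.eq_zero_or_pos (G.degree v) with h0 | hpos
  · calc 2 ≤ k + 1 - G.degree v := by lia
      _ ≤ _ := Finset.single_le_sum hnonneg (mem_component rfl)
  · obtain ⟨w, hvw⟩ := (G.degree_pos_iff_exists_adj v).1 hpos
    have hw : G.connectedComponentMk w = G.connectedComponentMk v :=
      (SimpleGraph.ConnectedComponent.connectedComponentMk_eq_of_adj hvw).symm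
    calc 2 ≤ (k + 1 - G.degree v) + (k + 1 - G.degree w) := by have := hdeg v; have := hdeg w; lia
      _ ≤ _ := Finset.add_le_sum (f := fun z => k + 1 - G.degree z) hnonneg (mem_component rfl)
        (mem_component hw) hvw.ne

theorem two_mul_card_edgeSet_add_card_connectedComponent_le (hk : 1 ≤ k)
    (hdeg : ∀ v, G.degree v ≤ k) :
    2 * (Nat.card G.edgeSet + Nat.card G.ConnectedComponent) ≤ (k + 1) * Fintype.card V := by
  classical
  have hdegrees := G.sum_degrees_eq_twice_card_edges
  have hcomponents : 2 * Fintype.card G.ConnectedComponent ≤ ∑ v, (k + 1 - G.degree v) := by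
    rw [← Finset.sum_fiberwise Finset.univ G.connectedComponentMk, mul_comm, ← smul_eq_mul,
      ← Finset.card_univ, ← Finset.sum_const]
    exact Finset.sum_le_sum fun C _ => two_le_sum_succ_sub_degree hk hdeg C
  have htotal : ∑ v, (k + 1 - G.degree v) + ∑ v, G.degree v = (k + 1) * Fintype.card V := by
    rw [← Finset.sum_add_distrib,
      Finset.sum_congr rfl fun v _ => Nat.sub_add_cancel ((hdeg v).trans k.le_succ),
      Finset.sum_const, Finset.card_univ, smul_eq_mul, mul_comm]
  rw [Nat.card_eq_fintype_card, Nat.card_eq_fintype_card, ← SimpleGraph.edgeFinset_card]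
  lia

end Degree

theorem planeDet_latticeVec_sqrt_two_ne_zero {u : ℤ × ℤ} (hu : IsCoprime u.1 u.2) :
    planeDet (latticeVec u) (1, √2) ≠ 0 := by
  intro hdet
  have heq : (u.1 : ℝ) * √2 = u.2 := by
    rwa [planeDet_apply, latticeVec, mul_one, sub_eq_zero] at hdet
  have hu₁ : u.1 ≠ 0 := by
    intro h0
    have hu₂ : u.2 = 0 := by rw [h0, Int.cast_zero, zero_mul, eq_comm] at heq; exact_mod_cast heq
    exact not_isCoprime_zero_zero (h0 ▸ hu₂ ▸ hu)
  exact (irrational_sqrt_two.intCast_mul hu₁).ne_int u.2 heq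

namespace PlaneGraph

variable {Γ : PlaneGraph}

theorem IsTropicalCurve.degree_le_card_star (h : Γ.IsTropicalCurve) [DecidableRel Γ.graph.Adj]
    (v : Fin Γ.n) : Γ.graph.degree v ≤ (Γ.star v).card := by
  choose! f hf using h.adj_heads v
  rw [← Γ.graph.card_neighborFinset_eq_degree]
  refine Finset.card_le_card_of_injOn f (fun w hw => ?_) fun w hw w' hw' hww' => ?_
  · exact (hf w (by simpa using hw)).1
  · exact h.heads_unique (hf w (by simpa using hw)) (hww' ▸ hf w' (by simpa using hw'))

theorem IsSmooth.card_edgeSet_add_card_connectedComponent_le (hs : Γ.IsSmooth)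
    (h : Γ.IsTropicalCurve) :
    Nat.card Γ.graph.edgeSet + Nat.card Γ.graph.ConnectedComponent ≤ 2 * Γ.n := by
  classical
  have hle := two_mul_card_edgeSet_add_card_connectedComponent_le (k := 3) (by norm_num)
    fun v => (h.degree_le_card_star v).trans (hs v).1.le
  rw [Fintype.card_fin] at hle
  lia

theorem TripodLabelling.IsAdmissible.mem_pullback_stableLocus {c : Plane}
    {L : Γ.TripodLabelling c} {η : ℝ} {δ : Fin Γ.n → Plane} (D : L.IsAdmissible η δ)
    (h : Γ.IsTropicalCurve) : Γ.pos + L.shift δ ∈ Γ.pullback Γ.n Γ.stableLocus := by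
  refine ⟨fun v => (h.isReversible.mem_support_iff h.star_nonempty).2 ?_, Γ.deform δ,
    D.isTropicalCurve h, (D.sameSubdividedDualPolygon h).sameDualPolygon,
    (D.isProperIntersection_deform h).isStableIntersection⟩
  exact ⟨v, _, L.star_eq v ▸ (L.tripod v).J_mem_star,
    openEdge_subset_closedEdge (D.pos_add_shift_mem_openEdge h v)⟩

end PlaneGraph

end

/-- The `m`-dimensional set of divisors is a nonempty relatively open piece `U ∩ L` of an
`m`-dimensional affine subspace `L` of `(ℝ²)^d`, contained in the pullback of `R_Γ^st` to `Γ^d`;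
its members are already cut out by smooth curves with the same subdivided dual polygon as `Γ`. -/
theorem mainTheorem4 (Γ : PlaneGraph) (hΓ : Γ.IsTropicalCurve) (hsmooth : Γ.IsSmooth) :
    ∃ (L : AffineSubspace ℝ (Fin Γ.n → Plane)) (U : Set (Fin Γ.n → Plane)),
      IsOpen U ∧ (U ∩ (L : Set (Fin Γ.n → Plane))).Nonempty ∧
      (Module.finrank ℝ L.direction : ℤ) = (Γ.n : ℤ) - Γ.genus ∧
      U ∩ (L : Set (Fin Γ.n → Plane)) ⊆ Γ.pullback Γ.n Γ.stableLocus ∧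
      ∀ x ∈ U ∩ (L : Set (Fin Γ.n → Plane)), ∃ Γ' : PlaneGraph,
        Γ'.IsTropicalCurve ∧ Γ'.IsSmooth ∧ Γ.SameSubdividedDualPolygon Γ' ∧
        Γ.IsStableIntersection Γ' (divisorOf x) := by
  obtain ⟨η, hη⟩ := hΓ.exists_isSmallScale
  obtain ⟨T⟩ := hsmooth.nonempty_tripodLabelling hΓ fun v u hu =>
    planeDet_latticeVec_sqrt_two_ne_zero (hΓ.primitive v u hu)
  obtain ⟨s, hs⟩ := T.exists_isAdmissible_const hη
  have hcard := hsmooth.card_edgeSet_add_card_connectedComponent_le hΓ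
  have hrank := T.two_mul_le_finrank_range_shift_add hΓ
  obtain ⟨L, U, hU, hne, hfinrank, hsub⟩ := exists_affineSubspace_inter_subset_image
    (T.shift.domRestrict Γ.slopeSpace) Γ.pos (T.isOpen_setOf_isAdmissible hη)
    ⟨⟨_, hs.mem_slopeSpace⟩, hs⟩ (m := 2 * Γ.n - (Nat.card Γ.graph.edgeSet +
      Nat.card Γ.graph.ConnectedComponent)) (by lia)
  refine ⟨L, U, hU, hne, ?_, fun x hx => ?_, fun x hx => ?_⟩
  · rw [hfinrank, PlaneGraph.genus, Nat.cast_sub hcard]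
    push_cast
    ring
  · obtain ⟨δ, D, rfl⟩ := hsub hx
    exact D.mem_pullback_stableLocus hΓ
  · obtain ⟨δ, D, rfl⟩ := hsub hx
    exact ⟨Γ.deform δ, D.isTropicalCurve hΓ, hsmooth, D.sameSubdividedDualPolygon hΓ,
      (D.isProperIntersection_deform hΓ).isStableIntersection⟩
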